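/- Consider $M$ operators with co-located base stations. The common sites $\mathbf x_0,\mathbf x_1,\dots$ form a homogeneous Poisson point process of intensity $\lambda>0$ on $\mathbb R^2$; the typical user, a user of operator $n$, is at the origin. Let $x_j=\|\mathbf x_j\|$. Given the sites, their link types are independent; site $j$ has a line-of-sight (type $\mathrm L$) link to the user with probability $p_{\mathrm L}(x_j)=e^{-\beta x_j}$ and a non-line-of-sight (type $\mathrm N$) link with probability $p_{\mathrm N}(x_j)=1-e^{-\beta x_j}$, where $\beta\ge 0$, and all base stations at a site have the same link type. A link of type $p$ and length $r$ has path loss $C_p r^{-\alpha_p}$ with $C_p,\alpha_p>0$. Base stations of operator $m$ transmit with power $P_m>0$. The base station of operator $m$ at site $j$ has fading $h_{mj}$, exponential with mean $1$; an angle $\theta_{mj}$, uniform on $(-\pi,\pi)$, to the user; and an indicator $\delta_{mj}\in\{0,1\}$ of being on, with $\mathbb P(\delta_{mj}=0)=\kappa(0)\in[0,1]$. All $h_{mj},\theta_{mj},\delta_{mj}$ are independent of each other and of the sites with their link types. The antenna gain is $G(\theta)=G_1$ if $|\theta|<\theta_{\mathrm b}$ and $G(\theta)=G_2$ otherwise,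 with $G_1,G_2\ge 0$ and $0\le\theta_{\mathrm b}\le\pi$. Under closed access the user is associated with the base station of operator $n$ at the site $i$ of largest average received power, i.e. with $P_nC_{p_i}x_i^{-\alpha_{p_i}}>P_nC_{p_j}x_j^{-\alpha_{p_j}}$ for all $j\neq i$, where $p_j$ is the link type of site $j$. Let $s=p_i$ and $x=x_i$ be the type and length of the serving link. Let $Q_n\ni n$ be the set of operators sharing the spectrum of operator $n$. The interference is $$I=x^{-\alpha_s}C_s\sum_{m\in Q_n\setminus\{n\}}P_mh_{mi}G(\theta_{mi})\delta_{mi}+\sum_{p\in\{\mathrm L,\mathrm N\}}\ \sum_{j\ne i,\ p_j=p}x_j^{-\alpha_p}C_p\sum_{m\in Q_n}P_mh_{mj}G(\theta_{mj})\delta_{mj}.$$ Then almost surely there is exactly one such serving site $i$, and for every $t\ge0$ the Laplace transform of $I$, given that the user is served over a link of type $s$ and length $x$ (that is, the conditional expectation given the random pair $(s,x)$), is almost surely $$\mathbb E\left[e^{-tI}\mid s,x\right]=\prod_{m\in Q_n\setminus\{n\}}H_m\!\left(x^{-\alpha_s}C_s\right)\ \prod_{p\in\{\mathrm L,\mathrm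 N\}}\exp\left(-2\pi\lambda\int_{D^s_p(x)}^\infty p_p(y)\left(1-\prod_{m\in Q_n}H_m\!\left(y^{-\alpha_p}C_p\right)\right)y\,\mathrm dy\right),$$ where $$H_m(\ell)=\kappa(0)+(1-\kappa(0))\left(\frac{\theta_{\mathrm b}/\pi}{1+t\ell P_mG_1}+\frac{(\pi-\theta_{\mathrm b})/\pi}{1+t\ell P_mG_2}\right),\qquad D^s_p(x)=\left(\frac{C_p}{C_s}\right)^{1/\alpha_p}x^{\alpha_s/\alpha_p}.$$ Here $I$ and the integrals take values in $[0,\infty]$, with $e^{-\infty}=0$ and $0\cdot\infty=0$. -/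

import Mathlib

open MeasureTheory ProbabilityTheory
open scoped ENNReal NNReal

noncomputable section

namespace MmWave

/-- The type of a radio link: line of sight or non line of sight. -/
inductive LinkType
  | LOS
  | NLOS
  deriving DecidableEq

instance : Fintype LinkType := ⟨{.LOS, .NLOS}, fun p => by cases p <;> simp⟩

instance : MeasurableSpace LinkType := ⊤

/-- The plane of base station locations; the typical user sits at the origin. -/
abbrev Plane := EuclideanSpace ℝ (Fin 2)

/-- System parameters for `M` operators whose base stations share the same sites. -/
structure Params (M : ℕ) where
  /-- density `λ` of the sites -/
  density : ℝ
  density_pos : 0 < density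
  /-- blocking parameter `β` -/
  blocking : ℝ
  blocking_nonneg : 0 ≤ blocking
  /-- path loss exponents `α_p` -/
  pathExp : LinkType → ℝ
  pathExp_pos : ∀ p, 0 < pathExp p
  /-- path loss gains `C_p` -/
  pathGain : LinkType → ℝ
  pathGain_pos : ∀ p, 0 < pathGain p
  /-- transmit powers `P_m` -/
  power : Fin M → ℝ
  power_pos : ∀ m, 0 < power m
  /-- antenna gain `G₁` in the main lobe -/
  mainGain : ℝ
  mainGain_nonneg : 0 ≤ mainGain
  /-- antenna gain `G₂` outside the main lobe -/
  sideGain : ℝ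
  sideGain_nonneg : 0 ≤ sideGain
  /-- half beamwidth `θ_b` -/
  halfBeam : ℝ
  halfBeam_nonneg : 0 ≤ halfBeam
  halfBeam_le : halfBeam ≤ Real.pi
  /-- probability `κ(0)` that a base station is off -/
  offProb : ℝ
  offProb_nonneg : 0 ≤ offProb
  offProb_le : offProb ≤ 1

namespace Params

variable {M : ℕ} (A : Params M)

/-- Probability that a link of length `r` has type `p`: `exp (-β r)` for LOS, and the
complementary probability for NLOS. -/
def linkProb : LinkType → ℝ → ℝ
  | .LOS, r => Real.exp (-A.blocking * r)
  | .NLOS, r => 1 - Real.exp (-A.blocking * r)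

/-- Path loss `ℓ_p(r) = C_p r ^ (-α_p)`. -/
def pathLoss (p : LinkType) (r : ℝ) : ℝ := A.pathGain p * r ^ (-A.pathExp p)

/-- Antenna pattern `G(θ)`. -/
def antenna (θ : ℝ) : ℝ := if |θ| < A.halfBeam then A.mainGain else A.sideGain

/-- Exclusion radius `D^s_p(x) = (C_p / C_s) ^ (1 / α_p) * x ^ (α_s / α_p)`. -/
def exclusionRadius (s p : LinkType) (x : ℝ) : ℝ :=
  (A.pathGain p / A.pathGain s) ^ (1 / A.pathExp p) * x ^ (A.pathExp s / A.pathExp p)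

/-- The partially loaded fading/antenna mixture factor of operator `m` at Laplace variable `t`
and path loss `l`. -/
def mixture (t l : ℝ) (m : Fin M) : ℝ :=
  A.offProb + (1 - A.offProb) *
    (A.halfBeam / Real.pi / (1 + t * l * A.power m * A.mainGain) +
      (Real.pi - A.halfBeam) / Real.pi / (1 + t * l * A.power m * A.sideGain))

end Params

/-- `exp (-a)` for `a ∈ [0, ∞]`, with `exp (-∞) = 0`. -/
def expNeg (a : ℝ≥0∞) : ℝ := if a = ∞ then 0 else Real.exp (-a.toReal)

/-- Number of points of the sequence `X 0, X 1, …` that lie in `B`. -/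
def pointCount {Ω E : Type*} (X : ℕ → Ω → E) (B : Set E) (ω : Ω) : ℕ∞ :=
  {j | X j ω ∈ B}.encard

/-- The points `X 0, X 1, …` form a Poisson point process with intensity measure `μ`. -/
structure IsPoissonProcess {Ω E : Type*} [MeasurableSpace Ω] [MeasurableSpace E]
    (X : ℕ → Ω → E) (μ : Measure E) (P : Measure Ω) : Prop where
  measurable : ∀ j, Measurable (X j)
  count_law : ∀ B : Set E, MeasurableSet B → μ B ≠ ∞ → ∀ k : ℕ,
    P {ω | pointCount X B ω = k} = poissonMeasure (μ B).toNNReal {k}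
  count_indep : ∀ (k : ℕ) (B : Fin k → Set E), (∀ i, MeasurableSet (B i)) →
    Pairwise (fun i i' => Disjoint (B i) (B i')) →
    iIndepFun (fun i => pointCount X (B i)) P

/-- The random elements of a network of co-located base stations. The base stations of all
operators at a site have the same link type to the typical user. -/
structure Network (Ω : Type*) (M : ℕ) where
  /-- location of the `j`-th site -/
  loc : ℕ → Ω → Plane
  /-- type of the links from the `j`-th site to the typical user -/
  link : ℕ → Ω → LinkType
  /-- fading `h_{mj}` -/
  fading : Fin M → ℕ → Ω → ℝ
  /-- antenna angle `θ_{mj}` of an interfering base station -/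
  angle : Fin M → ℕ → Ω → ℝ
  /-- whether the base station of operator `m` at site `j` is on -/
  isOn : Fin M → ℕ → Ω → Bool

/-- The law of the network: the sites form a homogeneous Poisson point process; given the sites,
the link types are independent and depend on the distance to the origin only; the fadings are
exponential with mean one, the angles are uniform on `(-π, π)`, each base station is off with
probability `κ(0)`, and all of these are independent of each other and of the sites and their
link types. -/
structure Network.HasLaw {Ω : Type*} [MeasurableSpace Ω] {M : ℕ} (N : Network Ω M)
    (A : Params M) (P : Measure Ω) : Prop where
  loc_poisson : IsPoissonProcess N.loc (ENNReal.ofReal A.density • volume) P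
  measurable_link : ∀ j, Measurable (N.link j)
  link_law : ∀ (J : Finset ℕ) (τ : ℕ → LinkType),
    P⟦{ω | ∀ j ∈ J, N.link j ω = τ j} |
        MeasurableSpace.comap (fun ω j => N.loc j ω) inferInstance⟧
      =ᵐ[P] fun ω => ∏ j ∈ J, A.linkProb (τ j) ‖N.loc j ω‖
  measurable_fading : ∀ m j, Measurable (N.fading m j)
  fading_law : ∀ m j, P.map (N.fading m j) = expMeasure 1
  measurable_angle : ∀ m j, Measurable (N.angle m j)
  angle_law : ∀ m j, pdf.IsUniform (N.angle m j) (Set.Ioo (-Real.pi) Real.pi) P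
  measurable_isOn : ∀ m j, Measurable (N.isOn m j)
  isOn_law : ∀ m j, P {ω | N.isOn m j ω = false} = ENNReal.ofReal A.offProb
  indep : iIndep
    (Sum.elim
      (fun _ : Unit =>
        MeasurableSpace.comap (fun ω (j : ℕ) => (N.loc j ω, N.link j ω)) inferInstance)
      (Sum.elim
        (fun a : Fin M × ℕ => MeasurableSpace.comap (N.fading a.1 a.2) inferInstance)
        (Sum.elim
          (fun a : Fin M × ℕ => MeasurableSpace.comap (N.angle a.1 a.2) inferInstance)
          (fun a : Fin M × ℕ => MeasurableSpace.comap (N.isOn a.1 a.2) inferInstance)))) P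

namespace Network

variable {Ω : Type*} {M : ℕ} (N : Network Ω M) (A : Params M)

/-- Average power received from the base station of operator `m` at site `j`, without the
antenna gain. -/
def avgPower (m : Fin M) (j : ℕ) (ω : Ω) : ℝ :=
  A.power m * A.pathLoss (N.link j ω) ‖N.loc j ω‖

/-- Under closed access, a user of operator `n` is associated with site `i` if no other base
station of operator `n` has an average received power as high as the one at site `i`. -/
def IsServing (n : Fin M) (ω : Ω) (i : ℕ) : Prop :=
  ∀ j, j ≠ i → N.avgPower A n j ω < N.avgPower A n i ω

/-- The (unique) serving site; `0` if there is none. -/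
def serving (n : Fin M) (ω : Ω) : ℕ := sInf {i | N.IsServing A n ω i}

/-- Link type of the serving base station. -/
def servingLink (n : Fin M) (ω : Ω) : LinkType := N.link (N.serving A n ω) ω

/-- Distance from the typical user to the serving base station. -/
def servingDist (n : Fin M) (ω : Ω) : ℝ := ‖N.loc (N.serving A n ω) ω‖

/-- `P_m h_{mj} G(θ_{mj}) δ_{mj}`: what the base station of operator `m` at site `j`
contributes, before path loss. -/
def emitted (m : Fin M) (j : ℕ) (ω : Ω) : ℝ :=
  A.power m * N.fading m j ω * A.antenna (N.angle m j ω) * (if N.isOn m j ω = true then 1 else 0)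

/-- Interference at the typical user of operator `n` from all operators in the sharing group `Q`:
the other operators at the serving site, and all operators at every other site. -/
def interference (Q : Finset (Fin M)) (n : Fin M) (ω : Ω) : ℝ≥0∞ :=
  ENNReal.ofReal (A.pathLoss (N.servingLink A n ω) (N.servingDist A n ω) *
      ∑ m ∈ Q.erase n, N.emitted A m (N.serving A n ω) ω) +
    ∑ p : LinkType, ∑' j : {j : ℕ // N.link j ω = p ∧ j ≠ N.serving A n ω},
      ENNReal.ofReal (A.pathLoss p ‖N.loc j ω‖ * ∑ m ∈ Q, N.emitted A m j ω)

end Network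

end MmWave

end

/-!
The sites enter the conditional Laplace transform only through exponentials of sums over the
process, so everything reduces to one identity for Poisson processes. The Laplace functional
`IsPoissonProcess.laplace` follows from the law of the counts. Differentiating it in the direction
of an indicator function gives the mean number of points in a set weighted by `exp (-∑ w)`, and
hence the Mecke formula `MeckeFormula`: the mean of `∑ᵢ u(xᵢ) ∏_{j ≠ i} exp (-w(xᵢ, xⱼ))` is
`∫ u(z) exp (-∫ (1 - exp (-w(z, y))) dy) dz`. Here `w = ∞` is allowed, which encodes that a site
must not be stronger than the distinguished one. It is enough to have this for exponents that
depend on `z` through a real parameter in a right continuous way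
(`IsPoissonProcess.meckeFormula_of_rightContinuous`).

Applied to ties, the Mecke formula shows that no two sites have the same average received power
(`IsPoissonProcess.ae_ne`). Since only finitely many sites are as strong as a given one, a unique
strongest site exists almost surely (`Network.HasLaw.ae_existsUnique_isServing`).

A function of the serving link times `exp (-t I)` is a sum over all sites `i`, in which the term of
`i` carries the factor `exp (-∞)` if another site is stronger (`Network.tsum_strongest_eq`). In each
term the fadings, angles and activities are integrated out, which gives the mixture factors
(`Network.HasLaw.lintegral_mul_prod_eExp_emitted`), and then, given the sites, the link types
(`Network.HasLaw.lintegral_prod_link`). What remains is a functional of the sites as in the Mecke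
formula, with the factor `Params.siteFactor` for each site. The result is the law of the pair
`(s, x)` weighted with `exp (-t I)` (`Network.HasLaw.lintegral_mul_eExp_interference`). In polar
coordinates, its exponent splits into the exponent for `t = 0`, which is that of the unweighted law,
and the integrals in the claim (`Params.lintegral_one_sub_siteFactor`). The quotient of the two
laws is therefore the asserted product, and this is what the conditional expectation means.
-/

namespace MmWave

/-! ### The exponential `exp (-a)` of an extended nonnegative real -/

/-- `exp (-a)` as an extended nonnegative real, for `a ∈ [0, ∞]`, with `exp (-∞) = 0`. -/
noncomputable def eExp (a : ℝ≥0∞) : ℝ≥0∞ := ENNReal.ofReal (expNeg a)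

lemma expNeg_nonneg (a : ℝ≥0∞) : 0 ≤ expNeg a := by
  unfold expNeg; split_ifs <;> positivity

/-- This gives access to the library of `EReal.exp : EReal → ℝ≥0∞`. -/
lemma eExp_eq_inv (a : ℝ≥0∞) : eExp a = (EReal.exp (a : EReal))⁻¹ := by
  rw [← EReal.exp_neg]
  induction a with
  | top => simp [eExp, expNeg]
  | coe a =>
    have : (((a : ℝ≥0∞) : EReal)) = ((a : ℝ) : EReal) := rfl
    rw [this, ← EReal.coe_neg, EReal.exp_coe]
    simp [eExp, expNeg]

@[simp] lemma eExp_zero : eExp 0 = 1 := by simp [eExp_eq_inv]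

@[simp] lemma eExp_top : eExp ∞ = 0 := by simp [eExp, expNeg]

lemma eExp_ofReal {r : ℝ} (hr : 0 ≤ r) :
    eExp (ENNReal.ofReal r) = ENNReal.ofReal (Real.exp (-r)) := by
  simp [eExp, expNeg, ENNReal.toReal_ofReal hr]

lemma eExp_add (a b : ℝ≥0∞) : eExp (a + b) = eExp a * eExp b := by
  have h (c : ℝ≥0∞) : EReal.exp (c : EReal) ≠ 0 := by simp
  rw [eExp_eq_inv, eExp_eq_inv, eExp_eq_inv, EReal.coe_ennreal_add, EReal.exp_add,
    ENNReal.mul_inv (Or.inl (h a)) (Or.inr (h b))]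

lemma eExp_antitone : Antitone eExp := fun a b h => by
  rw [eExp_eq_inv, eExp_eq_inv, ENNReal.inv_le_inv]
  exact EReal.exp_monotone (EReal.coe_ennreal_le_coe_ennreal_iff.2 h)

lemma eExp_le_one (a : ℝ≥0∞) : eExp a ≤ 1 := by
  simpa using eExp_antitone (zero_le : 0 ≤ a)

lemma eExp_ne_top (a : ℝ≥0∞) : eExp a ≠ ∞ := ne_top_of_le_ne_top ENNReal.one_ne_top (eExp_le_one a)

lemma eExp_ne_zero {a : ℝ≥0∞} (ha : a ≠ ∞) : eExp a ≠ 0 := by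
  simp [eExp_eq_inv, ha]

lemma toReal_eExp (a : ℝ≥0∞) : (eExp a).toReal = expNeg a :=
  ENNReal.toReal_ofReal (expNeg_nonneg a)

lemma continuous_eExp : Continuous eExp := by
  rw [show eExp = fun a : ℝ≥0∞ => (EReal.exp (a : EReal))⁻¹ from funext eExp_eq_inv]
  exact continuous_inv.comp
    (ENNReal.continuous_exp.comp continuous_coe_ennreal_ereal)

lemma measurable_eExp : Measurable eExp := continuous_eExp.measurable

lemma eExp_iSup {ι : Type*} [Nonempty ι] (f : ι → ℝ≥0∞) : eExp (⨆ i, f i) = ⨅ i, eExp (f i) :=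
  eExp_antitone.map_ciSup_of_continuousAt continuous_eExp.continuousAt

lemma eExp_sum {ι : Type*} (s : Finset ι) (f : ι → ℝ≥0∞) :
    eExp (∑ i ∈ s, f i) = ∏ i ∈ s, eExp (f i) := by
  classical
  induction s using Finset.induction_on with
  | empty => simp
  | insert a s ha ih => rw [Finset.sum_insert ha, Finset.prod_insert ha, eExp_add, ih]

lemma eExp_tsum (f : ℕ → ℝ≥0∞) :
    eExp (∑' j, f j) = ⨅ n, ∏ j ∈ Finset.range n, eExp (f j) := by
  rw [ENNReal.tsum_eq_iSup_nat, eExp_iSup]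
  simp_rw [eExp_sum]

/-- `-log x`, truncated below at `0`: the right inverse of `eExp` on `[0, 1]`. -/
noncomputable def negLog (x : ℝ≥0∞) : ℝ≥0∞ := (-(ENNReal.log x)).toENNReal

lemma measurable_negLog : Measurable negLog :=
  measurable_ereal_toENNReal.comp (ENNReal.measurable_log.neg)

lemma eExp_negLog {x : ℝ≥0∞} (hx : x ≤ 1) : eExp (negLog x) = x := by
  have h : 0 ≤ -(ENNReal.log x) := by
    rw [EReal.le_neg, neg_zero]
    simpa using ENNReal.log_monotone hx
  rw [eExp_eq_inv, negLog, EReal.coe_toENNReal h, EReal.exp_neg, ENNReal.exp_log, inv_inv]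

lemma negLog_antitone : Antitone negLog := fun _ _ h =>
  EReal.toENNReal_le_toENNReal (EReal.neg_le_neg_iff.2 (ENNReal.log_monotone h))

lemma eExp_natCast_mul {k : ℕ} {a : ℝ≥0∞} : eExp (k * a) = eExp a ^ k := by
  rw [← nsmul_eq_mul, ← Finset.card_range k, ← Finset.sum_const, eExp_sum, Finset.prod_const,
    Finset.card_range]

lemma tsum_iSup_of_monotone {f : ℕ → ℕ → ℝ≥0∞} (hf : ∀ j, Monotone fun n => f n j) :
    ∑' j, ⨆ n, f n j = ⨆ n, ∑' j, f n j := by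
  simp_rw [← lintegral_count]
  exact lintegral_iSup (fun n => Measurable.of_discrete) (fun m n h j => hf j h)

/-! ### The Laplace functional of a Poisson process -/

lemma toENNReal_pointCount {Ω E : Type*} (X : ℕ → Ω → E) (B : Set E) (ω : Ω) :
    (pointCount X B ω : ℝ≥0∞) = ∑' j, B.indicator (fun _ => (1 : ℝ≥0∞)) (X j ω) := by
  rw [pointCount, ← ENNReal.tsum_set_one, tsum_subtype {j | X j ω ∈ B} (fun _ => (1 : ℝ≥0∞))]
  rfl

lemma tsum_simpleFunc_comp {Ω E : Type*} [MeasurableSpace E] (X : ℕ → Ω → E)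
    (g : SimpleFunc E ℝ≥0∞) (ω : Ω) :
    ∑' j, g (X j ω) = ∑ a ∈ g.range, a * (pointCount X (g ⁻¹' {a}) ω : ℝ≥0∞) := by
  have h2 : ∀ x, g x = ∑ a ∈ g.range, a * (g ⁻¹' {a}).indicator (fun _ => (1 : ℝ≥0∞)) x := by
    intro x
    rw [Finset.sum_eq_single (g x)]
    · simp
    · intro b _ hb
      simp [Set.indicator, hb.symm]
    · intro hx; exact absurd (g.mem_range_self x) hx
  simp_rw [toENNReal_pointCount, ← ENNReal.tsum_mul_left]
  rw [← Summable.tsum_finsetSum (fun _ _ => ENNReal.summable)]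
  exact tsum_congr fun j => h2 _

section Laplace

variable {Ω E : Type*} [MeasurableSpace Ω] [MeasurableSpace E] {X : ℕ → Ω → E} {μ : Measure E}
  {P : Measure Ω}

lemma measurable_pointCount (hX : ∀ j, Measurable (X j)) {B : Set E} (hB : MeasurableSet B) :
    Measurable (pointCount X B) := by
  refine measurable_to_countable' fun k => ?_
  have : pointCount X B ⁻¹' {k} =
      {ω | ∑' j, B.indicator (fun _ => (1 : ℝ≥0∞)) (X j ω) = (k : ℝ≥0∞)} := by
    ext ω
    simp [← toENNReal_pointCount]
  rw [this]
  exact measurableSet_eq_fun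
    (Measurable.tsum fun j => (measurable_const.indicator hB).comp (hX j))
    measurable_const

/-- The counts are finite, since the Poisson probabilities add up to one over `ℕ`. -/
lemma IsPoissonProcess.pointCount_ne_top [IsProbabilityMeasure P] (hX : IsPoissonProcess X μ P)
    {B : Set E} (hB : MeasurableSet B) (hμ : μ B ≠ ∞) : ∀ᵐ ω ∂P, pointCount X B ω ≠ ⊤ := by
  have hm := measurable_pointCount hX.measurable hB
  have h1 : P {ω | pointCount X B ω ≠ ⊤} = 1 := by
    have : {ω | pointCount X B ω ≠ ⊤} = ⋃ k : ℕ, {ω | pointCount X B ω = k} := by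
      ext ω
      simp only [Set.mem_ofPred_eq, Set.mem_iUnion, ENat.ne_top_iff_exists, eq_comm]
    rw [this, measure_iUnion]
    · simp_rw [hX.count_law B hB hμ]
      rw [← measure_iUnion (fun i j h => by simpa using h) (fun _ => measurableSet_singleton _),
        Set.iUnion_of_singleton, measure_univ]
    · intro i j hij
      refine Set.disjoint_left.2 fun ω h h' => hij ?_
      have := h.symm.trans h'
      exact_mod_cast this
    · exact fun k => hm (measurableSet_singleton _)
  exact (prob_compl_eq_zero_iff (hm (measurableSet_singleton (⊤ : ℕ∞)).compl)).2 h1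

lemma IsPoissonProcess.lintegral_pointCount [IsProbabilityMeasure P] (hX : IsPoissonProcess X μ P)
    {B : Set E} (hB : MeasurableSet B) (hμ : μ B ≠ ∞) (g : ℕ∞ → ℝ≥0∞) :
    ∫⁻ ω, g (pointCount X B ω) ∂P = ∑' k : ℕ, g k * poissonMeasure (μ B).toNNReal {k} := by
  have hm := measurable_pointCount hX.measurable hB
  rw [← lintegral_map (f := g) Measurable.of_discrete hm, lintegral_countable']
  have h0 : P.map (pointCount X B) {⊤} = 0 := by
    rw [Measure.map_apply hm (measurableSet_singleton _)]
    have := hX.pointCount_ne_top hB hμ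
    rw [ae_iff] at this
    simp only [ne_eq, not_not] at this
    exact this
  have hsplit : ∑' a : ℕ∞, g a * P.map (pointCount X B) {a} =
      ∑' k : ℕ, g k * P.map (pointCount X B) {(k : ℕ∞)} := by
    symm
    refine Function.Injective.tsum_eq (f := fun a : ℕ∞ => g a * P.map (pointCount X B) {a})
      (g := fun k : ℕ => (k : ℕ∞)) Nat.cast_injective ?_
    intro a ha
    rcases eq_or_ne a ⊤ with rfl | h
    · simp [h0] at ha
    · obtain ⟨k, rfl⟩ := ENat.ne_top_iff_exists.1 h
      exact ⟨k, rfl⟩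
  rw [hsplit]
  congr 1 with k
  rw [← hX.count_law B hB hμ k, Measure.map_apply hm (measurableSet_singleton _)]
  rfl

lemma IsPoissonProcess.lintegral_eExp_pointCount [IsProbabilityMeasure P]
    (hX : IsPoissonProcess X μ P) {B : Set E} (hB : MeasurableSet B) (hμ : μ B ≠ ∞) (a : ℝ≥0∞) :
    ∫⁻ ω, eExp (a * pointCount X B ω) ∂P = eExp ((1 - eExp a) * μ B) := by
  rw [hX.lintegral_pointCount hB hμ (fun k => eExp (a * k))]
  set q : ℝ := expNeg a
  have hq : eExp a = ENNReal.ofReal q := rfl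
  have hq0 : 0 ≤ q := expNeg_nonneg a
  have hq1 : q ≤ 1 := by
    have := eExp_le_one a
    rwa [hq, ENNReal.ofReal_le_one] at this
  set r : ℝ≥0 := (μ B).toNNReal
  have hr : μ B = ENNReal.ofReal r := by simp [r, ENNReal.ofReal_coe_nnreal, hμ]
  have hterm (k : ℕ) : eExp (a * ((k : ℕ∞) : ℝ≥0∞)) * poissonMeasure r {k} =
      ENNReal.ofReal (Real.exp (-r) * ((q * r) ^ k / k.factorial)) := by
    rw [ENat.toENNReal_coe, mul_comm a, eExp_natCast_mul, poissonMeasure_singleton, hq,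
      ← ENNReal.ofReal_pow hq0, ← ENNReal.ofReal_mul (by positivity)]
    congr 1
    rw [mul_pow]; ring
  have hs : HasSum (fun k : ℕ => Real.exp (-r) * ((q * r) ^ k / k.factorial))
      (Real.exp (-r) * Real.exp (q * r)) := by
    have := NormedSpace.expSeries_div_hasSum_exp (q * r : ℝ)
    rw [← Real.exp_eq_exp_ℝ] at this
    exact this.mul_left _
  simp_rw [hterm]
  rw [← ENNReal.ofReal_tsum_of_nonneg (fun k => by positivity) hs.summable, hs.tsum_eq, hq, hr,
    ← ENNReal.ofReal_one, ← ENNReal.ofReal_sub _ hq0, ← ENNReal.ofReal_mul (by linarith),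
    eExp_ofReal (mul_nonneg (by linarith) r.coe_nonneg), ← Real.exp_add]
  congr 2; ring

lemma IsPoissonProcess.iIndepFun_pointCount (hX : IsPoissonProcess X μ P) {ι : Type*} [Finite ι]
    (B : ι → Set E) (hB : ∀ i, MeasurableSet (B i))
    (hd : Pairwise fun i i' => Disjoint (B i) (B i')) :
    iIndepFun (fun i => pointCount X (B i)) P := by
  obtain ⟨k, ⟨e⟩⟩ := Finite.exists_equiv_fin ι
  have := hX.count_indep k (fun i => B (e.symm i)) (fun i => hB _)
    (fun i i' h => hd (e.symm.injective.ne h))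
  simpa using this.precomp e.injective

lemma IsPoissonProcess.lintegral_eExp_sum_pointCount [IsProbabilityMeasure P]
    (hX : IsPoissonProcess X μ P) {ι : Type*} [Fintype ι]
    (B : ι → Set E) (hB : ∀ i, MeasurableSet (B i))
    (hd : Pairwise fun i i' => Disjoint (B i) (B i')) (hμ : ∀ i, μ (B i) ≠ ∞) (a : ι → ℝ≥0∞) :
    ∫⁻ ω, eExp (∑ i, a i * pointCount X (B i) ω) ∂P =
      eExp (∑ i, (1 - eExp (a i)) * μ (B i)) := by
  simp_rw [eExp_sum, ← hX.lintegral_eExp_pointCount (hB _) (hμ _)]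
  refine lintegral_prod_eq_prod_lintegral_of_indepFun Finset.univ
    (fun i ω => eExp (a i * pointCount X (B i) ω)) ?_ ?_
  · exact (hX.iIndepFun_pointCount B hB hd).comp (fun i k => eExp (a i * (k : ℝ≥0∞)))
      (fun i => Measurable.of_discrete)
  · intro i
    exact (Measurable.of_discrete (f := fun k : ℕ∞ => eExp (a i * (k : ℝ≥0∞)))).comp
      (measurable_pointCount hX.measurable (hB i))

lemma IsPoissonProcess.laplace_simpleFunc [IsProbabilityMeasure P] (hX : IsPoissonProcess X μ P)
    (g : SimpleFunc E ℝ≥0∞) (hg : ∀ a, a ≠ 0 → μ (g ⁻¹' {a}) ≠ ∞) :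
    ∫⁻ ω, eExp (∑' j, g (X j ω)) ∂P = eExp (∫⁻ x, (1 - eExp (g x)) ∂μ) := by
  classical
  have h1 (ω : Ω) : ∑' j, g (X j ω) =
      ∑ a : ↥(g.range.erase 0), (a : ℝ≥0∞) * (pointCount X (g ⁻¹' {(a : ℝ≥0∞)}) ω : ℝ≥0∞) := by
    rw [tsum_simpleFunc_comp, Finset.sum_coe_sort (g.range.erase 0)
      (fun a => a * (pointCount X (g ⁻¹' {a}) ω : ℝ≥0∞)), Finset.sum_erase]
    simp
  have h2 : ∫⁻ x, (1 - eExp (g x)) ∂μ =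
      ∑ a : ↥(g.range.erase 0), (1 - eExp a) * μ (g ⁻¹' {(a : ℝ≥0∞)}) := by
    have := (g.map fun a => 1 - eExp a).lintegral_eq_lintegral μ
    rw [SimpleFunc.map_lintegral] at this
    simp only [SimpleFunc.coe_map, Function.comp_apply] at this
    rw [this, Finset.sum_coe_sort (g.range.erase 0) (fun a => (1 - eExp a) * μ (g ⁻¹' {a})),
      Finset.sum_erase]
    simp
  simp_rw [h1, h2]
  refine hX.lintegral_eExp_sum_pointCount (fun a : ↥(g.range.erase 0) => g ⁻¹' {(a : ℝ≥0∞)})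
    (fun a => g.measurableSet_fiber _) ?_ ?_ _
  · intro a b hab
    refine Set.disjoint_left.2 fun x hx hx' => hab (Subtype.ext ?_)
    exact (Set.mem_singleton_iff.1 hx).symm.trans hx'
  · intro a
    exact hg _ (Finset.ne_of_mem_erase a.2)

/-- The Laplace functional of a Poisson process. Simple functions supported in sets of finite
intensity are covered by the law of the counts; they exhaust every measurable `w` from below. -/
theorem IsPoissonProcess.laplace [IsProbabilityMeasure P] [SigmaFinite μ]
    (hX : IsPoissonProcess X μ P) {w : E → ℝ≥0∞} (hw : Measurable w) :
    ∫⁻ ω, eExp (∑' j, w (X j ω)) ∂P = eExp (∫⁻ x, (1 - eExp (w x)) ∂μ) := by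
  classical
  let g : ℕ → SimpleFunc E ℝ≥0∞ := fun n =>
    (SimpleFunc.eapprox w n).restrict (spanningSets μ n)
  have hgv (n : ℕ) (x : E) : g n x =
      (spanningSets μ n).indicator (SimpleFunc.eapprox w n) x := by
    rw [SimpleFunc.restrict_apply _ (measurableSet_spanningSets μ n)]
  have hgmono (x : E) : Monotone fun n => g n x := by
    intro m n hmn
    simp only [hgv]
    by_cases hx : x ∈ spanningSets μ m
    · rw [Set.indicator_of_mem hx, Set.indicator_of_mem (monotone_spanningSets μ hmn hx)]
      exact SimpleFunc.monotone_eapprox w hmn x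
    · rw [Set.indicator_of_notMem hx]; exact zero_le
  have hgsup (x : E) : ⨆ n, g n x = w x := by
    apply le_antisymm
    · refine iSup_le fun n => ?_
      rw [hgv]
      refine (Set.indicator_le_self _ _ x).trans ?_
      rw [← SimpleFunc.iSup_eapprox_apply hw x]
      exact le_iSup (fun n => SimpleFunc.eapprox w n x) n
    · rw [← SimpleFunc.iSup_eapprox_apply hw x]
      refine iSup_le fun n => ?_
      have hx := mem_spanningSetsIndex μ x
      set m := spanningSetsIndex μ x
      refine le_trans ?_ (le_iSup (fun n => g n x) (max n m))
      simp only [hgv]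
      rw [Set.indicator_of_mem (monotone_spanningSets μ (le_max_right n m) hx)]
      exact SimpleFunc.monotone_eapprox w (le_max_left n m) x
  have hfin (n : ℕ) (a : ℝ≥0∞) (ha : a ≠ 0) : μ (g n ⁻¹' {a}) ≠ ∞ := by
    refine ne_top_of_le_ne_top (measure_spanningSets_lt_top μ n).ne (measure_mono ?_)
    intro x hx
    by_contra h
    apply ha
    rw [← Set.mem_singleton_iff.1 hx, hgv, Set.indicator_of_notMem h]
  have key (n : ℕ) := hX.laplace_simpleFunc (g n) (hfin n)
  have hL (ω : Ω) : eExp (∑' j, w (X j ω)) = ⨅ n, eExp (∑' j, g n (X j ω)) := by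
    rw [← eExp_iSup]
    congr 1
    simp_rw [← hgsup]
    exact tsum_iSup_of_monotone fun j => hgmono _
  have hR : eExp (∫⁻ x, (1 - eExp (w x)) ∂μ) = ⨅ n, eExp (∫⁻ x, (1 - eExp (g n x)) ∂μ) := by
    rw [← eExp_iSup, ← lintegral_iSup]
    · congr 2 with x
      rw [← hgsup, eExp_iSup, ENNReal.sub_iInf]
    · exact fun n => measurable_const.sub (measurable_eExp.comp (g n).measurable)
    · intro m n h x
      exact tsub_le_tsub_left (eExp_antitone (hgmono x h)) 1
  simp_rw [hL, hR, ← key]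
  refine lintegral_iInf (fun n => measurable_eExp.comp
    (Measurable.tsum fun j => (g n).measurable.comp (hX.measurable j))) ?_ ?_
  · intro m n h ω
    exact eExp_antitone (ENNReal.tsum_le_tsum fun j => hgmono _ h)
  · refine ne_top_of_le_ne_top ENNReal.one_ne_top ?_
    calc _ ≤ ∫⁻ _, 1 ∂P := lintegral_mono fun ω => eExp_le_one _
      _ = 1 := by simp

end Laplace

/-! ### The Mecke formula for products -/

lemma mul_geom_sum_add_pow {ε q : ℝ≥0∞} (h : ε + q = 1) (k : ℕ) :
    ε * ∑ i ∈ Finset.range k, q ^ i + q ^ k = 1 := by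
  induction k with
  | zero => simp
  | succ k ih =>
    rw [Finset.sum_range_succ, mul_add, pow_succ', add_assoc, ← add_mul, h, one_mul, ih]

/-- The difference quotients at `0` of `s ↦ 1 - exp (-s b)`, along `s = 1 / (n + 1)`. -/
lemma tendsto_mul_one_sub_eExp {b : ℝ≥0∞} (hb : b ≠ ∞) :
    Filter.Tendsto (fun n : ℕ => ENNReal.ofReal (n + 1) *
      (1 - eExp (ENNReal.ofReal (1 / (n + 1)) * b))) Filter.atTop (nhds b) := by
  lift b to ℝ≥0 using hb
  have hd : HasDerivAt (fun x : ℝ => -Real.exp (-(x * b))) b 0 := by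
    have h1 : HasDerivAt (fun x : ℝ => -(x * (b : ℝ))) (-(1 * (b : ℝ))) 0 :=
      ((hasDerivAt_id (0 : ℝ)).mul_const (b : ℝ)).neg
    simpa using h1.exp.fun_neg
  have hs : Filter.Tendsto (fun n : ℕ => 1 / ((n : ℝ) + 1)) Filter.atTop
      (nhdsWithin 0 (Set.Ioi 0)) :=
    tendsto_nhdsWithin_iff.2 ⟨tendsto_one_div_add_atTop_nhds_zero_nat,
      Filter.Eventually.of_forall fun n => Set.mem_Ioi.2 (by positivity)⟩
  have h := ENNReal.tendsto_ofReal (hd.tendsto_slope_zero_right.comp hs)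
  rw [ENNReal.ofReal_coe_nnreal] at h
  refine h.congr fun n => ?_
  have h0 : (0 : ℝ) ≤ 1 / (n + 1) * b := by positivity
  rw [← ENNReal.ofReal_coe_nnreal (p := b), ← ENNReal.ofReal_mul (by positivity), eExp_ofReal h0,
    ← ENNReal.ofReal_one, ← ENNReal.ofReal_sub _ (Real.exp_pos _).le,
    ← ENNReal.ofReal_mul (by positivity)]
  simp only [Function.comp_apply, zero_add, zero_mul, neg_zero, Real.exp_zero, smul_eq_mul]
  congr 1
  rw [one_div, inv_inv]
  ring

section Mecke

variable {Ω E : Type*} [MeasurableSpace Ω] [MeasurableSpace E] {X : ℕ → Ω → E} {μ : Measure E}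
  {P : Measure Ω} [IsProbabilityMeasure P]

/-- The expected number of points in `C`, weighted by a multiplicative functional: the derivative
at `s = 0` of the Laplace functional at `w + s 1_C`. -/
lemma IsPoissonProcess.lintegral_eExp_mul_pointCount [SigmaFinite μ]
    (hX : IsPoissonProcess X μ P) {w : E → ℝ≥0∞} (hw : Measurable w) {C : Set E}
    (hC : MeasurableSet C) (hμ : μ C ≠ ∞) :
    ∫⁻ ω, eExp (∑' j, w (X j ω)) * (pointCount X C ω : ℝ≥0∞) ∂P =
      eExp (∫⁻ x, (1 - eExp (w x)) ∂μ) * ∫⁻ x in C, eExp (w x) ∂μ := by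
  set Φ : Ω → ℝ≥0∞ := fun ω => eExp (∑' j, w (X j ω)) with hΦ
  set b : ℝ≥0∞ := ∫⁻ x in C, eExp (w x) ∂μ with hb
  set Λ : ℝ≥0∞ := eExp (∫⁻ x, (1 - eExp (w x)) ∂μ) with hΛ
  have hwe : Measurable fun x => eExp (w x) := measurable_eExp.comp hw
  have hΦm : Measurable Φ :=
    measurable_eExp.comp (Measurable.tsum fun j => hw.comp (hX.measurable j))
  have hΦ1 : ∫⁻ ω, Φ ω ∂P = Λ := hX.laplace hw
  have hΛt : Λ ≠ ∞ := eExp_ne_top _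
  have hbt : b ≠ ∞ := by
    refine ne_top_of_le_ne_top hμ ?_
    calc b ≤ ∫⁻ _ in C, 1 ∂μ := lintegral_mono fun x => eExp_le_one _
      _ = μ C := by simp
  set N : Ω → ℕ := fun ω => (pointCount X C ω).toNat with hN
  have hNm : Measurable N :=
    (Measurable.of_discrete (f := ENat.toNat)).comp (measurable_pointCount hX.measurable hC)
  have hNe : ∀ᵐ ω ∂P, pointCount X C ω = N ω := by
    filter_upwards [hX.pointCount_ne_top hC hμ] with ω hω
    exact (ENat.natCast_toNat hω).symm
  set ε : ℕ → ℝ≥0∞ := fun n => ENNReal.ofReal (1 / (n + 1)) with hε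
  set q : ℕ → ℝ≥0∞ := fun n => ENNReal.ofReal (1 - 1 / (n + 1)) with hq
  have hq0 (n : ℕ) : (0 : ℝ) ≤ 1 - 1 / (n + 1) := by
    rw [sub_nonneg, div_le_one (by positivity)]; linarith [n.cast_nonneg (α := ℝ)]
  have hεq (n : ℕ) : ε n + q n = 1 := by
    rw [hε, hq, ← ENNReal.ofReal_add (by positivity) (hq0 n)]; simp
  have hq1 (n : ℕ) : q n ≤ 1 := (hεq n) ▸ le_add_self
  have hqmono : Monotone q := by
    intro m n h
    refine ENNReal.ofReal_le_ofReal
      (sub_le_sub_left (one_div_le_one_div_of_le (by positivity) ?_) _)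
    have : (m : ℝ) ≤ n := by exact_mod_cast h
    linarith
  have hqlim : Filter.Tendsto q Filter.atTop (nhds 1) := by
    have := ENNReal.tendsto_ofReal
      ((tendsto_const_nhds (x := (1 : ℝ))).sub (tendsto_one_div_add_atTop_nhds_zero_nat (𝕜 := ℝ)))
    rw [hq]
    simpa using this
  -- the Laplace functional at `w + (-log q) 1_C`
  have hL (n : ℕ) : ∫⁻ ω, Φ ω * q n ^ N ω ∂P = Λ * eExp (ε n * b) := by
    set s := negLog (q n)
    have hs : eExp s = q n := eExp_negLog (hq1 n)
    have hw' : Measurable fun x => w x + C.indicator (fun _ => s) x :=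
      hw.add (measurable_const.indicator hC)
    have h := hX.laplace hw'
    have h1 : ∫⁻ ω, eExp (∑' j, (w (X j ω) + C.indicator (fun _ => s) (X j ω))) ∂P =
        ∫⁻ ω, Φ ω * q n ^ N ω ∂P := by
      refine lintegral_congr_ae ?_
      filter_upwards [hNe] with ω hω
      have hi (x : E) : C.indicator (fun _ => s) x = C.indicator (fun _ => (1 : ℝ≥0∞)) x * s := by
        by_cases hx : x ∈ C <;> simp [hx]
      simp_rw [ENNReal.tsum_add, hi, ENNReal.tsum_mul_right, ← toENNReal_pointCount]
      rw [eExp_add, hω, ENat.toENNReal_coe, eExp_natCast_mul, hs]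
    have h2 (x : E) : 1 - eExp (w x + C.indicator (fun _ => s) x) =
        (1 - eExp (w x)) + C.indicator (fun x => ε n * eExp (w x)) x := by
      by_cases hx : x ∈ C
      · simp only [hx, Set.indicator_of_mem, eExp_add, hs]
        refine ENNReal.sub_eq_of_eq_add_rev
          (ENNReal.mul_ne_top (eExp_ne_top _) (ne_top_of_le_ne_top ENNReal.one_ne_top (hq1 n))) ?_
        rw [add_comm, add_assoc, mul_comm (eExp (w x)), ← add_mul, hεq, one_mul,
          tsub_add_cancel_of_le (eExp_le_one _)]
      · simp [hx]
    rw [h1] at h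
    rw [h]
    simp_rw [h2]
    have hwm : Measurable fun x => 1 - eExp (w x) := measurable_const.sub hwe
    rw [lintegral_add_left hwm, eExp_add, lintegral_indicator hC,
      lintegral_const_mul _ hwe]
  -- by the geometric sum, `(1 - q ^ N) / (1 - q)` has expectation `(Λ - Λ exp (-ε b)) / ε`
  have hF (n : ℕ) : ∫⁻ ω, Φ ω * ∑ i ∈ Finset.range (N ω), q n ^ i ∂P =
      Λ * (ENNReal.ofReal (n + 1) * (1 - eExp (ε n * b))) := by
    have hFm : Measurable fun ω => Φ ω * ∑ i ∈ Finset.range (N ω), q n ^ i :=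
      hΦm.mul ((Measurable.of_discrete (f := fun k : ℕ => ∑ i ∈ Finset.range k, q n ^ i)).comp hNm)
    have h1 : ε n * ∫⁻ ω, Φ ω * ∑ i ∈ Finset.range (N ω), q n ^ i ∂P + Λ * eExp (ε n * b) = Λ := by
      rw [← hL n, ← lintegral_const_mul _ hFm, ← lintegral_add_left (hFm.const_mul _), ← hΦ1]
      refine lintegral_congr fun ω => ?_
      rw [mul_left_comm, ← mul_add, mul_geom_sum_add_pow (hεq n), mul_one]
    have hε1 : ENNReal.ofReal (n + 1) * ε n = 1 := by
      rw [hε, ← ENNReal.ofReal_mul (by positivity), mul_one_div_cancel (by positivity)]; simp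
    have h2 : ε n * ∫⁻ ω, Φ ω * ∑ i ∈ Finset.range (N ω), q n ^ i ∂P =
        Λ * (1 - eExp (ε n * b)) := by
      rw [ENNReal.mul_sub (fun _ _ => hΛt), mul_one]
      exact ENNReal.eq_sub_of_add_eq (ENNReal.mul_ne_top hΛt (eExp_ne_top _)) h1
    rw [mul_left_comm, ← h2, ← mul_assoc, hε1, one_mul]
  have hlim1 : Filter.Tendsto (fun n => ∫⁻ ω, Φ ω * ∑ i ∈ Finset.range (N ω), q n ^ i ∂P)
      Filter.atTop (nhds (∫⁻ ω, Φ ω * (N ω : ℝ≥0∞) ∂P)) := by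
    refine lintegral_tendsto_of_tendsto_of_monotone (fun n => ?_) ?_ ?_
    · exact (hΦm.mul ((Measurable.of_discrete
        (f := fun k : ℕ => ∑ i ∈ Finset.range k, q n ^ i)).comp hNm)).aemeasurable
    · refine Filter.Eventually.of_forall fun ω m n h => ?_
      simp only
      gcongr with i hi
      exact hqmono h
    · refine Filter.Eventually.of_forall fun ω => ?_
      refine ENNReal.Tendsto.const_mul ?_ (Or.inr (eExp_ne_top _))
      have : (N ω : ℝ≥0∞) = ∑ i ∈ Finset.range (N ω), (1 : ℝ≥0∞) ^ i := by simp
      rw [this]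
      exact tendsto_finsetSum _ fun i _ => ((ENNReal.continuous_pow i).tendsto 1).comp hqlim
  have hlim2 := ENNReal.Tendsto.const_mul (a := Λ) (tendsto_mul_one_sub_eExp hbt) (Or.inr hΛt)
  simp_rw [hF] at hlim1
  rw [← tendsto_nhds_unique hlim1 hlim2]
  refine lintegral_congr_ae ?_
  filter_upwards [hNe] with ω hω
  rw [hω, ENat.toENNReal_coe]

/-- Mecke's formula for a functional `f(x) ∏ exp (-w)` with the product over all points. -/
lemma IsPoissonProcess.lintegral_tsum_mul_eExp [SigmaFinite μ]
    (hX : IsPoissonProcess X μ P) {w : E → ℝ≥0∞} (hw : Measurable w) {f : E → ℝ≥0∞}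
    (hf : Measurable f) :
    ∫⁻ ω, ∑' i, f (X i ω) * eExp (∑' j, w (X j ω)) ∂P =
      eExp (∫⁻ x, (1 - eExp (w x)) ∂μ) * ∫⁻ x, eExp (w x) * f x ∂μ := by
  set Φ : Ω → ℝ≥0∞ := fun ω => eExp (∑' j, w (X j ω)) with hΦ
  have hwe : Measurable fun x => eExp (w x) := measurable_eExp.comp hw
  have hΦm : Measurable Φ :=
    measurable_eExp.comp (Measurable.tsum fun j => hw.comp (hX.measurable j))
  set ν : Measure E := Measure.sum fun i => (P.withDensity Φ).map (X i) with hν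
  have hνf {g : E → ℝ≥0∞} (hg : Measurable g) :
      ∫⁻ x, g x ∂ν = ∫⁻ ω, ∑' i, g (X i ω) * Φ ω ∂P := by
    rw [hν, lintegral_sum_measure, lintegral_tsum (f := fun i ω => g (X i ω) * Φ ω) fun i =>
      ((hg.comp (hX.measurable i)).mul hΦm).aemeasurable]
    congr 1 with i
    rw [lintegral_map hg (hX.measurable i),
      lintegral_withDensity_eq_lintegral_mul _ hΦm (g := fun ω => g (X i ω))
        (hg.comp (hX.measurable i))]
    exact lintegral_congr fun ω => mul_comm _ _
  -- `ν` is the Campbell measure weighted by `Φ`; it is known on the sets of finite intensity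
  have hmain : ν = eExp (∫⁻ x, (1 - eExp (w x)) ∂μ) • μ.withDensity fun x => eExp (w x) := by
    refine (Measure.ext_iff_of_iUnion_eq_univ (iUnion_spanningSets μ)).2 fun n => ?_
    ext B hB
    rw [Measure.restrict_apply hB, Measure.restrict_apply hB]
    have hC : MeasurableSet (B ∩ spanningSets μ n) := hB.inter (measurableSet_spanningSets μ n)
    have hCt : μ (B ∩ spanningSets μ n) ≠ ∞ :=
      ne_top_of_le_ne_top (measure_spanningSets_lt_top μ n).ne (measure_mono Set.inter_subset_right)
    generalize B ∩ spanningSets μ n = C at hC hCt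
    rw [← lintegral_indicator_one hC, hνf (measurable_one.indicator hC), Measure.smul_apply,
      withDensity_apply _ hC, smul_eq_mul, ← hX.lintegral_eExp_mul_pointCount hw hC hCt]
    refine lintegral_congr fun ω => ?_
    rw [ENNReal.tsum_mul_right, toENNReal_pointCount, mul_comm]
    rfl
  rw [← hνf hf, hmain, lintegral_smul_measure, lintegral_withDensity_eq_lintegral_mul _ hwe hf]
  rfl

variable (X μ P) in
/-- The reduced Mecke formula for the functional `(x, ξ) ↦ u(x) ∏_{y ∈ ξ} exp (-w(x, y))`. -/
def MeckeFormula (u : E → ℝ≥0∞) (w : E → E → ℝ≥0∞) : Prop :=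
  ∫⁻ ω, ∑' i, u (X i ω) * eExp (∑' j, if j = i then 0 else w (X i ω) (X j ω)) ∂P =
    ∫⁻ z, u z * eExp (∫⁻ y, (1 - eExp (w z y)) ∂μ) ∂μ

/-- If `w` is finite, the factor `exp (-w)` of the distinguished point can be divided out. -/
lemma IsPoissonProcess.meckeFormula_of_ne_top [SigmaFinite μ]
    (hX : IsPoissonProcess X μ P) {w : E → ℝ≥0∞} (hw : Measurable w) (hwt : ∀ x, w x ≠ ∞)
    {u : E → ℝ≥0∞} (hu : Measurable u) : MeckeFormula X μ P u fun _ y => w y := by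
  have hwe : Measurable fun x => eExp (w x) := measurable_eExp.comp hw
  have h := hX.lintegral_tsum_mul_eExp hw (f := fun x => (eExp (w x))⁻¹ * u x)
    (hwe.inv.mul hu)
  have hc (x : E) : eExp (w x) * (eExp (w x))⁻¹ = 1 :=
    ENNReal.mul_inv_cancel (eExp_ne_zero (hwt x)) (eExp_ne_top _)
  unfold MeckeFormula
  rw [lintegral_mul_const _ hu, mul_comm]
  simp_rw [← mul_assoc, hc, one_mul] at h
  rw [← h]
  refine lintegral_congr fun ω => tsum_congr fun i => ?_
  rw [ENNReal.tsum_eq_add_tsum_ite (f := fun j => w (X j ω)) i, eExp_add, mul_right_comm,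
    ← mul_assoc, mul_comm _ (eExp (w (X i ω))), hc, one_mul, mul_comm]
  congr!

/-- Campbell's formula. -/
lemma IsPoissonProcess.campbell [SigmaFinite μ]
    (hX : IsPoissonProcess X μ P) {u : E → ℝ≥0∞} (hu : Measurable u) :
    ∫⁻ ω, ∑' i, u (X i ω) ∂P = ∫⁻ z, u z ∂μ := by
  simpa [MeckeFormula] using
    hX.meckeFormula_of_ne_top (w := fun _ => 0) measurable_const (by simp) hu

lemma measurable_eExp_tsum_ite (hX : ∀ j, Measurable (X j)) {w : E → E → ℝ≥0∞}
    (hw : Measurable (Function.uncurry w)) (i : ℕ) :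
    Measurable fun ω => eExp (∑' j, if j = i then 0 else w (X i ω) (X j ω)) := by
  refine measurable_eExp.comp (Measurable.tsum fun j => ?_)
  split_ifs
  · exact measurable_const
  · exact hw.comp ((hX i).prodMk (hX j))

/-- The Mecke formula passes to increasing limits in the exponent. -/
lemma IsPoissonProcess.meckeFormula_iSup [SigmaFinite μ] (hX : IsPoissonProcess X μ P)
    {u : E → ℝ≥0∞} (hu : Measurable u) (hu1 : ∀ z, u z ≤ 1) (hut : ∫⁻ z, u z ∂μ ≠ ∞)
    {w : ℕ → E → E → ℝ≥0∞} (hw : ∀ n, Measurable (Function.uncurry (w n)))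
    (hmono : ∀ z y, Monotone fun n => w n z y) (h : ∀ n, MeckeFormula X μ P u (w n)) :
    MeckeFormula X μ P u fun z y => ⨆ n, w n z y := by
  have hut' (z : E) : u z ≠ ∞ := ne_top_of_le_ne_top ENNReal.one_ne_top (hu1 z)
  have hmul {a b c : ℝ≥0∞} (hbc : b ≤ c) : a * eExp c ≤ a * eExp b :=
    mul_le_mul_right (eExp_antitone hbc) a
  have hle1 (a b : ℝ≥0∞) : a * eExp b ≤ a := mul_le_of_le_one_right' (eExp_le_one b)
  set S : ℕ → ℕ → Ω → ℝ≥0∞ := fun n i ω => ∑' j, if j = i then 0 else w n (X i ω) (X j ω) with hS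
  have hSmono (i : ℕ) (ω : Ω) : Monotone fun n => S n i ω := by
    intro m n hmn
    refine ENNReal.tsum_le_tsum fun j => ?_
    split_ifs
    · exact le_rfl
    · exact hmono _ _ hmn
  have hSsup (i : ℕ) (ω : Ω) :
      ∑' j, (if j = i then 0 else ⨆ n, w n (X i ω) (X j ω)) = ⨆ n, S n i ω := by
    rw [hS, ← tsum_iSup_of_monotone]
    · refine tsum_congr fun j => ?_
      split_ifs <;> simp
    · intro j m n hmn
      dsimp only
      split_ifs
      · exact le_rfl
      · exact hmono _ _ hmn
  have hSm (n i : ℕ) : Measurable fun ω => u (X i ω) * eExp (S n i ω) :=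
    (hu.comp (hX.measurable i)).mul (measurable_eExp_tsum_ite hX.measurable (hw n) i)
  have hlim (a : ℝ≥0∞) (f : ℕ → ℝ≥0∞) (ha : a ≠ ∞) (hf : Monotone f) :
      Filter.Tendsto (fun n => a * eExp (f n)) Filter.atTop (nhds (a * eExp (⨆ n, f n))) :=
    ENNReal.Tendsto.const_mul ((continuous_eExp.tendsto _).comp (tendsto_atTop_iSup hf))
      (Or.inr ha)
  have hC := hX.campbell hu
  have hbd : ∀ᵐ ω ∂P, ∑' i, u (X i ω) ≠ ∞ := by
    have : ∫⁻ ω, ∑' i, u (X i ω) ∂P ≠ ∞ := hC ▸ hut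
    filter_upwards [ae_lt_top (Measurable.tsum fun i => hu.comp (hX.measurable i)) this] with ω hω
    exact hω.ne
  have h1 : Filter.Tendsto (fun n => ∫⁻ ω, ∑' i, u (X i ω) * eExp (S n i ω) ∂P) Filter.atTop
      (nhds (∫⁻ ω, ∑' i, u (X i ω) * eExp (⨆ n, S n i ω) ∂P)) := by
    refine lintegral_tendsto_of_tendsto_of_antitone
      (fun n => (Measurable.tsum fun i => hSm n i).aemeasurable)
      (Filter.Eventually.of_forall fun ω m n hmn =>
        ENNReal.tsum_le_tsum fun i => hmul (hSmono i ω hmn)) ?_ ?_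
    · refine ne_top_of_le_ne_top hut (hC ▸ lintegral_mono fun ω => ?_)
      exact ENNReal.tsum_le_tsum fun i => hle1 _ _
    · filter_upwards [hbd] with ω hω
      simp_rw [← lintegral_count]
      refine lintegral_tendsto_of_tendsto_of_antitone
        (fun n => Measurable.of_discrete.aemeasurable)
        (Filter.Eventually.of_forall fun i m n hmn => hmul (hSmono i ω hmn)) ?_
        (Filter.Eventually.of_forall fun i => hlim _ _ (hut' _) (hSmono i ω))
      rw [lintegral_count]
      exact ne_top_of_le_ne_top hω (ENNReal.tsum_le_tsum fun i => hle1 _ _)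
  set T : ℕ → E → ℝ≥0∞ := fun n z => ∫⁻ y, (1 - eExp (w n z y)) ∂μ with hT
  have hTmono (z : E) : Monotone fun n => T n z := fun m n hmn =>
    lintegral_mono fun y => tsub_le_tsub_left (eExp_antitone (hmono z y hmn)) 1
  have hTsup (z : E) : ∫⁻ y, (1 - eExp (⨆ n, w n z y)) ∂μ = ⨆ n, T n z := by
    rw [hT, ← lintegral_iSup]
    · refine lintegral_congr fun y => ?_
      rw [eExp_iSup, ENNReal.sub_iInf]
    · exact fun n => measurable_const.sub
        (measurable_eExp.comp ((hw n).comp measurable_prodMk_left))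
    · exact fun m n hmn y => tsub_le_tsub_left (eExp_antitone (hmono z y hmn)) 1
  have hTm (n : ℕ) : Measurable (T n) :=
    (measurable_const.sub (measurable_eExp.comp (hw n))).lintegral_prod_right'
  have h2 : Filter.Tendsto (fun n => ∫⁻ z, u z * eExp (T n z) ∂μ) Filter.atTop
      (nhds (∫⁻ z, u z * eExp (⨆ n, T n z) ∂μ)) :=
    lintegral_tendsto_of_tendsto_of_antitone
      (fun n => (hu.mul (measurable_eExp.comp (hTm n))).aemeasurable)
      (Filter.Eventually.of_forall fun z m n hmn => hmul (hTmono z hmn))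
      (ne_top_of_le_ne_top hut (lintegral_mono fun z => hle1 _ _))
      (Filter.Eventually.of_forall fun z => hlim _ _ (hut' _) (hTmono z))
  unfold MeckeFormula at h ⊢
  simp_rw [hSsup, hTsup]
  exact tendsto_nhds_unique h1 (h2.congr fun n => (h n).symm)

end Mecke

/-! ### The Mecke formula with an exponent depending on the distinguished point -/

section MeckeLimits

variable {Ω E : Type*} [MeasurableSpace Ω] [MeasurableSpace E] {X : ℕ → Ω → E} {μ : Measure E}
  {P : Measure Ω} [SigmaFinite μ]

/-- The Mecke formula extends from integrable weights to all bounded ones. -/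
lemma meckeFormula_of_integrable (hX : ∀ j, Measurable (X j)) {w : E → E → ℝ≥0∞}
    (hw : Measurable (Function.uncurry w))
    (h : ∀ u : E → ℝ≥0∞, Measurable u → (∀ z, u z ≤ 1) → ∫⁻ z, u z ∂μ ≠ ∞ →
      MeckeFormula X μ P u w)
    {u : E → ℝ≥0∞} (hu : Measurable u) (hu1 : ∀ z, u z ≤ 1) : MeckeFormula X μ P u w := by
  set v : ℕ → E → ℝ≥0∞ := fun n => (spanningSets μ n).indicator u with hv
  have hvm (n : ℕ) : Measurable (v n) := hu.indicator (measurableSet_spanningSets μ n)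
  have hv1 (n : ℕ) (z : E) : v n z ≤ (spanningSets μ n).indicator 1 z :=
    Set.indicator_le_indicator (hu1 z)
  have hvmono (z : E) : Monotone fun n => v n z := fun m n hmn =>
    Set.indicator_le_indicator_of_subset (monotone_spanningSets μ hmn) (fun _ => zero_le) z
  have hvsup (z : E) : ⨆ n, v n z = u z := by
    refine le_antisymm (iSup_le fun n => Set.indicator_le_self _ _ z) ?_
    refine le_trans ?_ (le_iSup (fun n => v n z) (spanningSetsIndex μ z))
    simp [hv, mem_spanningSetsIndex μ z]
  have hvt (n : ℕ) : ∫⁻ z, v n z ∂μ ≠ ∞ := by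
    refine ne_top_of_le_ne_top (measure_spanningSets_lt_top μ n).ne ?_
    rw [← lintegral_indicator_one (measurableSet_spanningSets μ n)]
    exact lintegral_mono (hv1 n)
  have h' (n : ℕ) := h (v n) (hvm n)
    (fun z => (Set.indicator_le_self _ _ z).trans (hu1 z)) (hvt n)
  have hI : Measurable fun z => eExp (∫⁻ y, (1 - eExp (w z y)) ∂μ) :=
    measurable_eExp.comp (measurable_const.sub (measurable_eExp.comp hw)).lintegral_prod_right'
  have hJ (i : ℕ) := measurable_eExp_tsum_ite hX hw i
  unfold MeckeFormula at h' ⊢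
  simp_rw [← hvsup, ENNReal.iSup_mul]
  rw [lintegral_iSup (f := fun n z => v n z * eExp (∫⁻ y, (1 - eExp (w z y)) ∂μ))
    (fun n => (hvm n).mul hI) (fun m n hmn z => mul_le_mul_left (hvmono z hmn) _)]
  simp_rw [← h']
  rw [← lintegral_iSup]
  · refine lintegral_congr fun ω => ?_
    exact tsum_iSup_of_monotone fun i m n hmn => mul_le_mul_left (hvmono _ hmn) _
  · exact fun n => Measurable.tsum fun i => ((hvm n).comp (hX i)).mul (hJ i)
  · exact fun m n hmn ω => ENNReal.tsum_le_tsum fun i => mul_le_mul_left (hvmono _ hmn) _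

variable [IsProbabilityMeasure P]

/-- An exponent with values in `[0, ∞]` is the increasing limit of its truncations. -/
lemma IsPoissonProcess.meckeFormula_const (hX : IsPoissonProcess X μ P)
    {w : E → ℝ≥0∞} (hw : Measurable w)
    {u : E → ℝ≥0∞} (hu : Measurable u) (hu1 : ∀ z, u z ≤ 1) (hut : ∫⁻ z, u z ∂μ ≠ ∞) :
    MeckeFormula X μ P u fun _ y => w y := by
  have h := hX.meckeFormula_iSup hu hu1 hut (w := fun n _ y => min (w y) n)
    (fun n => (hw.min measurable_const).comp measurable_snd)
    (fun z y m n hmn => min_le_min_left _ (by exact_mod_cast hmn))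
    (fun n => hX.meckeFormula_of_ne_top (hw.min measurable_const)
      (fun x => ne_top_of_le_ne_top (ENNReal.natCast_ne_top n) (min_le_right _ _)) hu)
  have (y : E) : ⨆ n : ℕ, min (w y) n = w y := by
    rw [← inf_iSup_eq, ENNReal.iSup_natCast, inf_top_eq]
  simpa only [this] using h

/-- The Mecke formula when the exponent depends on the distinguished point through a countable
partition only. -/
lemma IsPoissonProcess.meckeFormula_countable (hX : IsPoissonProcess X μ P)
    {ι : Type*} [Countable ι] [MeasurableSpace ι] [MeasurableSingletonClass ι] {k : E → ι}
    (hk : Measurable k) {W : ι → E → ℝ≥0∞} (hW : ∀ c, Measurable (W c))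
    {u : E → ℝ≥0∞} (hu : Measurable u) (hu1 : ∀ z, u z ≤ 1) (hut : ∫⁻ z, u z ∂μ ≠ ∞) :
    MeckeFormula X μ P u fun z y => W (k z) y := by
  set v : ι → E → ℝ≥0∞ := fun c => (k ⁻¹' {c}).indicator u with hv
  have hvm (c : ι) : Measurable (v c) := hu.indicator (hk (measurableSet_singleton c))
  have hvu (c : ι) (z : E) : v c z ≤ u z := Set.indicator_le_self _ _ z
  have hsplit (z : E) (F : ι → ℝ≥0∞) : u z * F (k z) = ∑' c, v c z * F c := by
    rw [tsum_eq_single (k z)]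
    · simp [hv]
    · intro c hc
      simp [hv, hc.symm]
  have h (c : ι) : MeckeFormula X μ P (v c) fun _ y => W c y :=
    hX.meckeFormula_const (hW c) (hvm c) (fun z => (hvu c z).trans (hu1 z))
      (ne_top_of_le_ne_top hut (lintegral_mono fun z => hvu c z))
  have hJ (c : ι) (i : ℕ) : Measurable fun ω => eExp (∑' j, if j = i then 0 else W c (X j ω)) :=
    measurable_eExp_tsum_ite hX.measurable (w := fun _ y => W c y) ((hW c).comp measurable_snd) i
  unfold MeckeFormula at h ⊢
  calc ∫⁻ ω, ∑' i, u (X i ω) * eExp (∑' j, if j = i then 0 else W (k (X i ω)) (X j ω)) ∂P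
      = ∫⁻ ω, ∑' c, ∑' i, v c (X i ω) * eExp (∑' j, if j = i then 0 else W c (X j ω)) ∂P := by
        refine lintegral_congr fun ω => ?_
        rw [ENNReal.tsum_comm]
        exact tsum_congr fun i => hsplit (X i ω)
          fun c => eExp (∑' j, if j = i then 0 else W c (X j ω))
    _ = ∑' c, ∫⁻ z, v c z * eExp (∫⁻ y, (1 - eExp (W c y)) ∂μ) ∂μ := by
        rw [lintegral_tsum]
        · exact tsum_congr h
        · intro c
          exact (Measurable.tsum fun i => ((hvm c).comp (hX.measurable i)).mul
            (hJ c i)).aemeasurable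
    _ = ∫⁻ z, u z * eExp (∫⁻ y, (1 - eExp (W (k z) y)) ∂μ) ∂μ := by
        rw [← lintegral_tsum fun c => ((hvm c).mul_const _).aemeasurable]
        exact lintegral_congr fun z =>
          (hsplit z fun c => eExp (∫⁻ y, (1 - eExp (W c y)) ∂μ)).symm

/-- The Mecke formula when the exponent depends on the distinguished point through a real
parameter, in a decreasing and right continuous way: the parameter is approximated from above by
dyadic numbers. -/
lemma IsPoissonProcess.meckeFormula_of_rightContinuous (hX : IsPoissonProcess X μ P)
    {ρ : E → ℝ} (hρ : Measurable ρ) {W : ℝ → E → ℝ≥0∞} (hW : ∀ r, Measurable (W r))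
    (hanti : ∀ y, Antitone fun r => W r y)
    (hcont : ∀ r y, Filter.Tendsto (fun r' => W r' y) (nhdsWithin r (Set.Ioi r)) (nhds (W r y)))
    {u : E → ℝ≥0∞} (hu : Measurable u) (hu1 : ∀ z, u z ≤ 1) :
    MeckeFormula X μ P u fun z y => W (ρ z) y := by
  let D : ℕ → ℤ → ℝ := fun n c => (c + 1) / 2 ^ n
  let K : ℕ → E → ℤ := fun n z => ⌊2 ^ n * ρ z⌋
  have hK (n : ℕ) : Measurable (K n) := (hρ.const_mul _).floor
  have hDgt (n : ℕ) (z : E) : ρ z < D n (K n z) := by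
    rw [lt_div_iff₀ (by positivity), mul_comm]
    exact Int.lt_floor_add_one _
  have hDle (n : ℕ) (z : E) : D n (K n z) ≤ ρ z + (1 / 2) ^ n := by
    rw [div_le_iff₀ (by positivity), add_mul, ← mul_pow]
    have := Int.floor_le (2 ^ n * ρ z)
    norm_num
    linarith [this]
  have hDanti (z : E) : Antitone fun n => D n (K n z) := by
    refine antitone_nat_of_succ_le fun n => ?_
    have h1 : (K (n + 1) z : ℤ) < 2 * (K n z + 1) := by
      rw [Int.floor_lt]
      have := Int.lt_floor_add_one (2 ^ n * ρ z)
      push_cast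
      rw [pow_succ]
      linarith
    have h2 : ((K (n + 1) z : ℝ) + 1) ≤ 2 * (K n z + 1) := by
      have : K (n + 1) z + 1 ≤ 2 * (K n z + 1) := h1
      exact_mod_cast this
    simp only [D]
    rw [div_le_div_iff₀ (by positivity) (by positivity), pow_succ]
    nlinarith [pow_pos (two_pos (α := ℝ)) n]
  have hDlim (z : E) : Filter.Tendsto (fun n => D n (K n z)) Filter.atTop
      (nhdsWithin (ρ z) (Set.Ioi (ρ z))) := by
    refine tendsto_nhdsWithin_iff.2 ⟨?_, Filter.Eventually.of_forall fun n => hDgt n z⟩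
    refine tendsto_of_tendsto_of_tendsto_of_le_of_le tendsto_const_nhds ?_
      (fun n => (hDgt n z).le) (fun n => hDle n z)
    simpa using (tendsto_const_nhds (x := ρ z)).add
      (tendsto_pow_atTop_nhds_zero_of_lt_one (by norm_num : (0 : ℝ) ≤ 1 / 2) (by norm_num))
  have hmono (z y : E) : Monotone fun n => W (D n (K n z)) y := fun m n hmn =>
    hanti y (hDanti z hmn)
  have hsup (z y : E) : ⨆ n, W (D n (K n z)) y = W (ρ z) y :=
    tendsto_nhds_unique (tendsto_atTop_iSup (hmono z y)) ((hcont (ρ z) y).comp (hDlim z))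
  have hmeas (n : ℕ) : Measurable (Function.uncurry fun z y => W (D n (K n z)) y) := by
    have : Measurable fun p : ℤ × E => W (D n p.1) p.2 :=
      measurable_from_prod_countable_right fun c => hW (D n c)
    exact this.comp (((hK n).comp measurable_fst).prodMk measurable_snd)
  have hmeas' : Measurable (Function.uncurry fun z y => W (ρ z) y) := by
    have : (Function.uncurry fun z y => W (ρ z) y) =
        fun p : E × E => ⨆ n, W (D n (K n p.1)) p.2 := by
      ext p; exact (hsup _ _).symm
    rw [this]
    exact Measurable.iSup hmeas
  refine meckeFormula_of_integrable hX.measurable hmeas' (fun u hu hu1 hut => ?_) hu hu1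
  have := hX.meckeFormula_iSup hu hu1 hut hmeas hmono fun n =>
    hX.meckeFormula_countable (hK n) (fun c => hW (D n c)) hu hu1 hut
  simpa only [hsup] using this

/-- Almost surely, no two distinct points of the process satisfy `ψ y = φ x`, if the level sets
of `ψ` are null sets. The Mecke formula with exponent `∞` on ties shows that the points without a
partner have the same mean measure as all points. -/
theorem IsPoissonProcess.ae_ne (hX : IsPoissonProcess X μ P) {φ ψ : E → ℝ} (hφ : Measurable φ)
    (hψ : Measurable ψ) (hfin : ∀ r, μ (ψ ⁻¹' Metric.closedBall r 1) ≠ ∞)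
    (hnull : ∀ r, μ (ψ ⁻¹' {r}) = 0) :
    ∀ᵐ ω ∂P, ∀ i j, j ≠ i → ψ (X j ω) ≠ φ (X i ω) := by
  -- the exponent is `∞` if the value of `ψ` lies in the same cell of length `1 / (n + 1)` as `φ`
  let cell (n : ℕ) (c : ℤ) : Set E := {y | ⌊(n + 1) * ψ y⌋ = c}
  let K (n : ℕ) (z : E) : ℤ := ⌊(n + 1) * φ z⌋
  have hcell (n : ℕ) (c : ℤ) : MeasurableSet (cell n c) :=
    (hψ.const_mul _).floor (measurableSet_singleton c)
  have hK (n : ℕ) : Measurable (K n) := (hφ.const_mul _).floor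
  let W (n : ℕ) (c : ℤ) : E → ℝ≥0∞ := (cell n c).indicator fun _ => ∞
  have hW (n : ℕ) (c : ℤ) : Measurable (W n c) := measurable_const.indicator (hcell n c)
  let w : E → E → ℝ≥0∞ := fun z y => Set.indicator {y | ψ y = φ z} (fun _ => ∞) y
  have hw : Measurable (Function.uncurry w) := by
    have : Function.uncurry w = Set.indicator {p : E × E | ψ p.2 = φ p.1} fun _ => ∞ := by
      ext p; rfl
    rw [this]
    exact measurable_const.indicator
      (measurableSet_eq_fun (hψ.comp measurable_snd) (hφ.comp measurable_fst))
  have hwW (n : ℕ) (z y : E) : w z y ≤ W n (K n z) y := by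
    by_cases h : ψ y = φ z
    · have : y ∈ cell n (K n z) := by simp [cell, K, h]
      simp [W, this]
    · simp [w, h]
  have hWint (n : ℕ) (c : ℤ) : ∫⁻ y, (1 - eExp (W n c y)) ∂μ = μ (cell n c) := by
    rw [← lintegral_indicator_one (hcell n c)]
    refine lintegral_congr fun y => ?_
    by_cases h : y ∈ cell n c <;> simp [W, h]
  let A (z : E) (n : ℕ) : Set E := ψ ⁻¹' Metric.closedBall (φ z) (1 / (n + 1))
  have hcA (n : ℕ) (z : E) : cell n (K n z) ⊆ A z n := by
    intro y hy
    have h := Int.abs_sub_lt_one_of_floor_eq_floor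
      (Set.mem_ofPred_eq ▸ hy : ⌊((n : ℝ) + 1) * ψ y⌋ = _)
    rw [← mul_sub, abs_mul, abs_of_pos (by positivity)] at h
    simp only [A, Set.mem_preimage, Metric.mem_closedBall, Real.dist_eq]
    rw [le_div_iff₀ (by positivity), mul_comm]
    exact h.le
  have hA0 (z : E) : Filter.Tendsto (fun n => μ (A z n)) Filter.atTop (nhds 0) := by
    have hAanti : Antitone (A z) := by
      intro m n hmn
      refine Set.preimage_mono (Metric.closedBall_subset_closedBall ?_)
      exact one_div_le_one_div_of_le (by positivity) (by gcongr)
    have h := tendsto_measure_iInter_atTop (μ := μ) (s := A z)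
      (fun n => (hψ measurableSet_closedBall).nullMeasurableSet) hAanti
      ⟨0, by simpa [A] using hfin _⟩
    have hI : ⋂ n, A z n ⊆ ψ ⁻¹' {φ z} := by
      intro y hy
      rw [Set.mem_iInter] at hy
      refine eq_of_abs_sub_nonpos (le_of_tendsto_of_tendsto tendsto_const_nhds
        (tendsto_one_div_add_atTop_nhds_zero_nat (𝕜 := ℝ))
        (Filter.Eventually.of_forall fun n => ?_))
      exact hy n
    rwa [measure_mono_null hI (hnull _)] at h
  -- it suffices to consider distinguished points in a set of finite measure
  suffices hS : ∀ m, ∀ᵐ ω ∂P, ∀ i, X i ω ∈ spanningSets μ m →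
      ∀ j, j ≠ i → ψ (X j ω) ≠ φ (X i ω) by
    filter_upwards [ae_all_iff.2 hS] with ω hω i
    exact hω _ i (mem_spanningSetsIndex μ (X i ω))
  intro m
  set u : E → ℝ≥0∞ := (spanningSets μ m).indicator 1 with hu_def
  have hu : Measurable u := measurable_one.indicator (measurableSet_spanningSets μ m)
  have hu1 (z : E) : u z ≤ 1 := Set.indicator_le_self _ (1 : E → ℝ≥0∞) z
  have hut : ∫⁻ z, u z ∂μ ≠ ∞ := by
    rw [hu_def, lintegral_indicator_one (measurableSet_spanningSets μ m)]
    exact (measure_spanningSets_lt_top μ m).ne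
  have hM (n : ℕ) : ∫⁻ ω, ∑' i, u (X i ω) *
      eExp (∑' j, if j = i then 0 else W n (K n (X i ω)) (X j ω)) ∂P =
      ∫⁻ z, u z * eExp (μ (cell n (K n z))) ∂μ := by
    have := hX.meckeFormula_countable (hK n) (hW n) hu hu1 hut
    unfold MeckeFormula at this
    rw [this]
    simp_rw [hWint]
  set F : Ω → ℝ≥0∞ := fun ω => ∑' i, u (X i ω) *
    eExp (∑' j, if j = i then 0 else w (X i ω) (X j ω)) with hF
  set G : Ω → ℝ≥0∞ := fun ω => ∑' i, u (X i ω) with hG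
  have hFle (ω : Ω) : F ω ≤ G ω :=
    ENNReal.tsum_le_tsum fun i => mul_le_of_le_one_right' (eExp_le_one _)
  have hGint : ∫⁻ ω, G ω ∂P = ∫⁻ z, u z ∂μ := hX.campbell hu
  have hGm : Measurable G := Measurable.tsum fun i => hu.comp (hX.measurable i)
  have hlim : Filter.Tendsto (fun n => ∫⁻ z, u z * eExp (μ (cell n (K n z))) ∂μ) Filter.atTop
      (nhds (∫⁻ z, u z ∂μ)) := by
    refine tendsto_lintegral_of_dominated_convergence u (fun n => ?_)
      (fun n => Filter.Eventually.of_forall fun z => mul_le_of_le_one_right' (eExp_le_one _)) hut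
      (Filter.Eventually.of_forall fun z => ?_)
    · exact hu.mul ((Measurable.of_discrete (f := fun c : ℤ => eExp (μ (cell n c)))).comp (hK n))
    · have h0 : Filter.Tendsto (fun n => μ (cell n (K n z))) Filter.atTop (nhds 0) :=
        tendsto_of_tendsto_of_tendsto_of_le_of_le tendsto_const_nhds (hA0 z)
          (fun n => zero_le) (fun n => measure_mono (hcA n z))
      have h1 := (continuous_eExp.tendsto 0).comp h0
      rw [eExp_zero] at h1
      simpa using ENNReal.Tendsto.const_mul h1
        (Or.inr (ne_top_of_le_ne_top ENNReal.one_ne_top (hu1 z)))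
  have hGF : ∫⁻ ω, G ω ∂P ≤ ∫⁻ ω, F ω ∂P := by
    rw [hGint]
    refine le_of_tendsto hlim (Filter.Eventually.of_forall fun n => ?_)
    rw [← hM n]
    refine lintegral_mono fun ω => ENNReal.tsum_le_tsum fun i => mul_le_mul_right ?_ _
    refine eExp_antitone (ENNReal.tsum_le_tsum fun j => ?_)
    split_ifs
    · exact le_rfl
    · exact hwW n _ _
  have hFt : ∫⁻ ω, F ω ∂P ≠ ∞ :=
    ne_top_of_le_ne_top (hGint ▸ hut) (lintegral_mono hFle)
  filter_upwards [ae_eq_of_ae_le_of_lintegral_le (Filter.Eventually.of_forall hFle) hFt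
    hGm.aemeasurable hGF, ae_lt_top hGm (hGint ▸ hut)] with ω hω hωt i hi j hji hij
  refine (ENNReal.tsum_lt_tsum (i := i) (hω ▸ hωt.ne : F ω ≠ ∞)
    (fun i => mul_le_of_le_one_right' (eExp_le_one _)) ?_).ne hω
  have htop : ∑' j, (if j = i then 0 else w (X i ω) (X j ω)) = ∞ :=
    ENNReal.tsum_eq_top_of_eq_top ⟨j, by simp [hji, w, hij]⟩
  rw [htop, eExp_top, mul_zero, hu_def, Set.indicator_of_mem hi]
  exact one_pos

end MeckeLimits

/-! ### Fading, antenna gain and activity of a single base station -/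

section Laws

variable {Ω : Type*} {mΩ : MeasurableSpace Ω} {P : Measure Ω}

/-- Integrating out a variable that is independent of everything else in the integrand. -/
lemma lintegral_mul_comp_of_indep {Ω β γ : Type*} {m mΩ : MeasurableSpace Ω} {P : Measure Ω}
    [IsProbabilityMeasure P] [MeasurableSpace β] [MeasurableSpace γ] (hm : m ≤ mΩ) {Z : Ω → β}
    (hZ : Measurable Z)
    (hind : Indep m (MeasurableSpace.comap Z inferInstance) P) {Φ : Ω → ℝ≥0∞}
    (hΦ : Measurable[m] Φ) {c : Ω → γ} (hc : Measurable[m] c) {k : γ → β → ℝ≥0∞}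
    (hk : Measurable (Function.uncurry k)) :
    ∫⁻ ω, Φ ω * k (c ω) (Z ω) ∂P = ∫⁻ ω, Φ ω * ∫⁻ z, k (c ω) z ∂(P.map Z) ∂P := by
  have hY : Measurable[m] fun ω => (Φ ω, c ω) := hΦ.prodMk hc
  have hY' : Measurable fun ω => (Φ ω, c ω) := hY.mono hm le_rfl
  have hYZ : IndepFun (fun ω => (Φ ω, c ω)) Z P :=
    (IndepFun_iff_Indep _ _ _).2 (indep_of_indep_of_le_left hind hY.comap_le)
  have hmap := (indepFun_iff_map_prod_eq_prod_map_map hY'.aemeasurable hZ.aemeasurable).1 hYZ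
  have hF : Measurable fun p : (ℝ≥0∞ × γ) × β => p.1.1 * k p.1.2 p.2 :=
    (measurable_fst.comp measurable_fst).mul
      (hk.comp ((measurable_snd.comp measurable_fst).prodMk measurable_snd))
  have : IsProbabilityMeasure (P.map Z) := Measure.isProbabilityMeasure_map hZ.aemeasurable
  have : IsProbabilityMeasure (P.map fun ω => (Φ ω, c ω)) :=
    Measure.isProbabilityMeasure_map hY'.aemeasurable
  calc ∫⁻ ω, Φ ω * k (c ω) (Z ω) ∂P
      = ∫⁻ p, p.1.1 * k p.1.2 p.2 ∂(P.map fun ω => ((Φ ω, c ω), Z ω)) :=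
        (lintegral_map hF (hY'.prodMk hZ)).symm
    _ = ∫⁻ y, ∫⁻ z, y.1 * k y.2 z ∂(P.map Z) ∂(P.map fun ω => (Φ ω, c ω)) := by
        rw [hmap, lintegral_prod _ hF.aemeasurable]
    _ = ∫⁻ ω, ∫⁻ z, Φ ω * k (c ω) z ∂(P.map Z) ∂P :=
        lintegral_map (f := fun y : ℝ≥0∞ × γ => ∫⁻ z, y.1 * k y.2 z ∂(P.map Z))
          hF.lintegral_prod_right' hY'
    _ = _ := lintegral_congr fun ω =>
        lintegral_const_mul _ (hk.comp measurable_prodMk_left)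

lemma lintegral_eExp_expMeasure {a : ℝ} (ha : 0 ≤ a) :
    ∫⁻ x, eExp (ENNReal.ofReal (a * x)) ∂(expMeasure 1) = ENNReal.ofReal (1 / (1 + a)) := by
  have ha' : 0 < 1 + a := by linarith
  have hmeas : Measurable fun x : ℝ => eExp (ENNReal.ofReal (a * x)) :=
    measurable_eExp.comp (measurable_const_mul a).ennreal_ofReal
  have h1 : expMeasure 1 = volume.withDensity (exponentialPDF 1) := rfl
  rw [h1, lintegral_withDensity_eq_lintegral_mul _ (f := exponentialPDF 1)
    (measurable_exponentialPDFReal 1).ennreal_ofReal hmeas, ← mul_one (ENNReal.ofReal _),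
    ← lintegral_exponentialPDF_eq_one ha', ← lintegral_const_mul _
    (f := exponentialPDF (1 + a)) (measurable_exponentialPDFReal _).ennreal_ofReal]
  refine lintegral_congr fun x => ?_
  rcases lt_or_ge x 0 with hx | hx
  · simp [exponentialPDF_of_neg hx]
  · rw [Pi.mul_apply, exponentialPDF_of_nonneg hx, exponentialPDF_of_nonneg hx,
      eExp_ofReal (mul_nonneg ha hx), ← ENNReal.ofReal_mul (by positivity),
      ← ENNReal.ofReal_mul (by positivity), one_mul, one_mul, ← Real.exp_add, ← mul_assoc,
      one_div, inv_mul_cancel₀ ha'.ne', one_mul]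
    congr 2; ring

lemma Params.lintegral_antenna {M : ℕ} (A : Params M) {θ : Ω → ℝ}
    (hlaw : pdf.IsUniform θ (Set.Ioo (-Real.pi) Real.pi) P) (g : ℝ → ℝ≥0∞) :
    ∫⁻ x, g (A.antenna x) ∂(P.map θ) =
      ENNReal.ofReal (A.halfBeam / Real.pi) * g A.mainGain +
        ENNReal.ofReal ((Real.pi - A.halfBeam) / Real.pi) * g A.sideGain := by
  have hpi := Real.pi_pos
  have hvol : volume (Set.Ioo (-Real.pi) Real.pi) = ENNReal.ofReal (2 * Real.pi) := by
    rw [Real.volume_Ioo]; congr 1; ring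
  have hB : MeasurableSet {x : ℝ | |x| < A.halfBeam} :=
    measurableSet_lt measurable_id.abs measurable_const
  have hB' : {x : ℝ | |x| < A.halfBeam} ∩ Set.Ioo (-Real.pi) Real.pi =
      Set.Ioo (-A.halfBeam) A.halfBeam := by
    have := A.halfBeam_le
    ext x
    simp only [Set.mem_inter_iff, Set.mem_ofPred_eq, Set.mem_Ioo, abs_lt]
    constructor
    · exact fun h => h.1
    · exact fun h => ⟨h, by linarith [h.1], by linarith [h.2]⟩
  have hprob : IsProbabilityMeasure (ProbabilityTheory.cond volume (Set.Ioo (-Real.pi) Real.pi)) :=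
    cond_isProbabilityMeasure_of_finite (by rw [hvol]; simp [hpi])
      (by rw [hvol]; exact ENNReal.ofReal_ne_top)
  have h1 : ProbabilityTheory.cond volume (Set.Ioo (-Real.pi) Real.pi) {x | |x| < A.halfBeam} =
      ENNReal.ofReal (A.halfBeam / Real.pi) := by
    rw [cond_apply measurableSet_Ioo, Set.inter_comm, hB', hvol, Real.volume_Ioo,
      ← ENNReal.ofReal_inv_of_pos (by positivity), ← ENNReal.ofReal_mul (by positivity)]
    congr 1
    field_simp
    ring
  have h2 : ProbabilityTheory.cond volume (Set.Ioo (-Real.pi) Real.pi) {x | |x| < A.halfBeam}ᶜ =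
      ENNReal.ofReal ((Real.pi - A.halfBeam) / Real.pi) := by
    rw [prob_compl_eq_one_sub hB, h1, ← ENNReal.ofReal_one,
      ← ENNReal.ofReal_sub _ (div_nonneg A.halfBeam_nonneg hpi.le), sub_div, div_self hpi.ne']
  rw [pdf.IsUniform] at hlaw
  rw [hlaw, ← lintegral_add_compl _ hB, setLIntegral_congr_fun (g := fun _ => g A.mainGain) hB,
    setLIntegral_congr_fun (g := fun _ => g A.sideGain) hB.compl, setLIntegral_const,
    setLIntegral_const, h1, h2, mul_comm, mul_comm (g A.sideGain)]
  · intro x hx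
    simp only [Params.antenna, if_neg (show ¬ |x| < A.halfBeam from hx)]
  · intro x hx
    simp only [Params.antenna, if_pos (show |x| < A.halfBeam from hx)]

lemma Params.lintegral_isOn [IsProbabilityMeasure P] {M : ℕ} (A : Params M) {δ : Ω → Bool}
    (hδ : Measurable δ) (hlaw : P {ω | δ ω = false} = ENNReal.ofReal A.offProb)
    (g : Bool → ℝ≥0∞) :
    ∫⁻ b, g b ∂(P.map δ) =
      ENNReal.ofReal A.offProb * g false + ENNReal.ofReal (1 - A.offProb) * g true := by
  have h1 : P {ω | δ ω = true} = ENNReal.ofReal (1 - A.offProb) := by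
    have : {ω | δ ω = true} = {ω | δ ω = false}ᶜ := by ext ω; simp
    rw [this, prob_compl_eq_one_sub (s := {ω | δ ω = false})
      (hδ (measurableSet_singleton false)), hlaw,
      ← ENNReal.ofReal_one, ← ENNReal.ofReal_sub _ A.offProb_nonneg]
  rw [lintegral_fintype, Fintype.sum_bool, Measure.map_apply hδ (measurableSet_singleton _),
    Measure.map_apply hδ (measurableSet_singleton _), add_comm, mul_comm, mul_comm (g true)]
  exact congrArg₂ (fun a b => a * g false + b * g true) hlaw h1

end Laws

/-! ### Integrating out the fadings, angles and activities -/

namespace Params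

variable {M : ℕ} (A : Params M)

lemma measurable_antenna : Measurable A.antenna :=
  Measurable.ite (measurableSet_lt measurable_id.abs measurable_const) measurable_const
    measurable_const

lemma antenna_nonneg (θ : ℝ) : 0 ≤ A.antenna θ := by
  unfold antenna
  split_ifs
  exacts [A.mainGain_nonneg, A.sideGain_nonneg]

lemma measurable_mixture (t : ℝ) (m : Fin M) : Measurable fun l => A.mixture t l m := by
  unfold mixture
  fun_prop

lemma mixture_nonneg {t l : ℝ} (ht : 0 ≤ t) (hl : 0 ≤ l) (m : Fin M) : 0 ≤ A.mixture t l m := by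
  have h1 := A.offProb_nonneg
  have h2 := A.offProb_le
  have h3 := A.halfBeam_nonneg
  have h4 := A.halfBeam_le
  have h5 := A.mainGain_nonneg
  have h6 := A.sideGain_nonneg
  have h7 := (A.power_pos m).le
  have h8 := Real.pi_pos
  unfold mixture
  have : 0 ≤ Real.pi - A.halfBeam := by linarith
  have : 0 ≤ 1 - A.offProb := by linarith
  positivity

lemma mixture_le_one {t l : ℝ} (ht : 0 ≤ t) (hl : 0 ≤ l) (m : Fin M) : A.mixture t l m ≤ 1 := by
  have h1 := A.offProb_nonneg
  have h2 := A.offProb_le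
  have h3 := A.halfBeam_nonneg
  have h4 := A.halfBeam_le
  have h5 := A.mainGain_nonneg
  have h6 := A.sideGain_nonneg
  have h7 := (A.power_pos m).le
  have h8 := Real.pi_pos
  have hb : A.halfBeam / Real.pi + (Real.pi - A.halfBeam) / Real.pi = 1 := by field_simp; ring
  have d1 : A.halfBeam / Real.pi / (1 + t * l * A.power m * A.mainGain) ≤ A.halfBeam / Real.pi :=
    div_le_self (by positivity) (le_add_of_nonneg_right (by positivity))
  have d2 : (Real.pi - A.halfBeam) / Real.pi / (1 + t * l * A.power m * A.sideGain) ≤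
      (Real.pi - A.halfBeam) / Real.pi :=
    div_le_self (div_nonneg (by linarith) h8.le) (le_add_of_nonneg_right (by positivity))
  unfold mixture
  nlinarith

lemma mixture_zero_left (l : ℝ) (m : Fin M) : A.mixture 0 l m = 1 := by
  have h8 := Real.pi_pos
  unfold mixture
  field_simp
  ring

lemma pathLoss_nonneg (p : LinkType) {r : ℝ} (hr : 0 ≤ r) : 0 ≤ A.pathLoss p r :=
  mul_nonneg (A.pathGain_pos p).le (Real.rpow_nonneg hr _)

lemma measurable_pathLoss (p : LinkType) : Measurable (A.pathLoss p) := by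
  unfold pathLoss
  fun_prop

end Params

namespace Network

variable {Ω : Type*} {M : ℕ} (N : Network Ω M)

/-- The σ-algebra of the sites and their link types. -/
abbrev siteAlg : MeasurableSpace Ω :=
  MeasurableSpace.comap (fun ω (j : ℕ) => (N.loc j ω, N.link j ω)) inferInstance

/-- The independent σ-algebras of the network: the sites with their link types, each fading, each
angle and each activity indicator. -/
abbrev sources : Unit ⊕ (Fin M × ℕ) ⊕ (Fin M × ℕ) ⊕ (Fin M × ℕ) → MeasurableSpace Ω :=
  Sum.elim (fun _ => N.siteAlg)
    (Sum.elim (fun a => MeasurableSpace.comap (N.fading a.1 a.2) inferInstance)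
      (Sum.elim (fun a => MeasurableSpace.comap (N.angle a.1 a.2) inferInstance)
        (fun a => MeasurableSpace.comap (N.isOn a.1 a.2) inferInstance)))

/-- The σ-algebra of everything but the marks of the base station `a`. -/
abbrev othersAlg (a : Fin M × ℕ) : MeasurableSpace Ω :=
  ⨆ i ∈ ({.inr (.inl a), .inr (.inr (.inl a)), .inr (.inr (.inr a))}ᶜ : Set _), N.sources i

variable {N}

lemma siteAlg_le_othersAlg (a : Fin M × ℕ) : N.siteAlg ≤ N.othersAlg a :=
  le_iSup₂_of_le (f := fun i (_ : i ∈ _) => N.sources i) (.inl ()) (by simp) le_rfl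

lemma measurable_emitted_of_le {A : Params M} {m' : MeasurableSpace Ω} {m : Fin M} {j : ℕ}
    (h1 : Measurable[m'] (N.fading m j)) (h2 : Measurable[m'] (N.angle m j))
    (h3 : Measurable[m'] (N.isOn m j)) : Measurable[m'] (N.emitted A m j) :=
  ((measurable_const.mul h1).mul (A.measurable_antenna.comp h2)).mul
    (Measurable.of_discrete (f := fun b : Bool => if b = true then (1 : ℝ) else 0) |>.comp h3)

lemma measurable_emitted_othersAlg {A : Params M} {a b : Fin M × ℕ} (hab : a ≠ b) :
    Measurable[N.othersAlg b] (N.emitted A a.1 a.2) := by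
  have hle (i) (hi : i ∈ ({.inr (.inl b), .inr (.inr (.inl b)), .inr (.inr (.inr b))}ᶜ : Set _)) :
      N.sources i ≤ N.othersAlg b :=
    le_iSup₂_of_le (f := fun i (_ : i ∈ _) => N.sources i) i hi le_rfl
  refine measurable_emitted_of_le ?_ ?_ ?_
  · exact (comap_measurable (N.fading a.1 a.2)).mono (hle (.inr (.inl a)) (by simp [hab])) le_rfl
  · exact (comap_measurable (N.angle a.1 a.2)).mono
      (hle (.inr (.inr (.inl a))) (by simp [hab])) le_rfl
  · exact (comap_measurable (N.isOn a.1 a.2)).mono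
      (hle (.inr (.inr (.inr a))) (by simp [hab])) le_rfl

variable [mΩ : MeasurableSpace Ω] {A : Params M} {P : Measure Ω}

lemma HasLaw.iIndep_sources (hN : N.HasLaw A P) : iIndep N.sources P := hN.indep

lemma HasLaw.siteAlg_le (hN : N.HasLaw A P) : N.siteAlg ≤ mΩ :=
  (measurable_pi_lambda _ fun j =>
    (hN.loc_poisson.measurable j).prodMk (hN.measurable_link j)).comap_le

lemma HasLaw.sources_le (hN : N.HasLaw A P) (i) : N.sources i ≤ mΩ := by
  rcases i with _ | a | a | a
  exacts [hN.siteAlg_le, (hN.measurable_fading _ _).comap_le, (hN.measurable_angle _ _).comap_le,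
    (hN.measurable_isOn _ _).comap_le]

lemma HasLaw.indep_source (hN : N.HasLaw A P) (i₀) :
    Indep (⨆ i ∈ ({i₀}ᶜ : Set _), N.sources i) (N.sources i₀) P := by
  have := indep_iSup_of_disjoint hN.sources_le hN.iIndep_sources
    (disjoint_compl_left (a := ({i₀} : Set _)))
  rwa [iSup_singleton] at this

/-- The Laplace transform of what one base station emits is the mixture factor, also in the
presence of factors that do not involve this base station. -/
lemma HasLaw.lintegral_mul_eExp_emitted [IsProbabilityMeasure P] (hN : N.HasLaw A P)
    (a : Fin M × ℕ) {Φ : Ω → ℝ≥0∞} (hΦ : Measurable[N.othersAlg a] Φ) {l : Ω → ℝ}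
    (hl : Measurable[N.othersAlg a] l) (hl0 : ∀ ω, 0 ≤ l ω) {t : ℝ} (ht : 0 ≤ t) :
    ∫⁻ ω, Φ ω * eExp (ENNReal.ofReal (t * (l ω * N.emitted A a.1 a.2 ω))) ∂P =
      ∫⁻ ω, Φ ω * ENNReal.ofReal (A.mixture t (l ω) a.1) ∂P := by
  set δ : Bool → ℝ := fun b => if b = true then 1 else 0 with hδ
  have hδ0 (b : Bool) : 0 ≤ δ b := by unfold δ; split_ifs <;> norm_num
  have hδm : Measurable δ := Measurable.of_discrete
  have hP := (A.power_pos a.1).le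
  have hle (i₀) (hi₀ : i₀ = .inr (.inl a) ∨ i₀ = .inr (.inr (.inl a)) ∨
      i₀ = .inr (.inr (.inr a))) :
      N.othersAlg a ≤ ⨆ i ∈ ({i₀}ᶜ : Set _), N.sources i := by
    refine biSup_mono fun i hi => ?_
    rintro (rfl : i = i₀)
    rcases hi₀ with h | h | h <;> simp_all
  have hle' (i₀ i) (h : i ≠ i₀) : N.sources i ≤ ⨆ i ∈ ({i₀}ᶜ : Set _), N.sources i :=
    le_iSup₂_of_le (f := fun i (_ : i ∈ _) => N.sources i) i h le_rfl
  have hm (i₀) : (⨆ i ∈ ({i₀}ᶜ : Set _), N.sources i) ≤ mΩ :=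
    iSup₂_le fun i _ => hN.sources_le i
  -- the fading
  have h1 : ∫⁻ ω, Φ ω * eExp (ENNReal.ofReal (t * (l ω * N.emitted A a.1 a.2 ω))) ∂P =
      ∫⁻ ω, Φ ω * ENNReal.ofReal (1 / (1 + t * l ω * A.power a.1 *
        A.antenna (N.angle a.1 a.2 ω) * δ (N.isOn a.1 a.2 ω))) ∂P := by
    have hind := hN.indep_source (.inr (.inl a))
    have hc : Measurable[⨆ i ∈ ({.inr (.inl a)}ᶜ : Set _), N.sources i] fun ω =>
        t * l ω * A.power a.1 * A.antenna (N.angle a.1 a.2 ω) * δ (N.isOn a.1 a.2 ω) := by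
      refine ((((hl.mono (hle _ (by simp)) le_rfl).const_mul t).mul_const _).mul
        (A.measurable_antenna.comp ?_)).mul (hδm.comp ?_)
      · exact (comap_measurable (N.angle a.1 a.2)).mono
          (hle' (.inr (.inl a)) (.inr (.inr (.inl a))) (by simp)) le_rfl
      · exact (comap_measurable (N.isOn a.1 a.2)).mono
          (hle' (.inr (.inl a)) (.inr (.inr (.inr a))) (by simp)) le_rfl
    have := lintegral_mul_comp_of_indep (hm _) (hN.measurable_fading a.1 a.2) hind
      (hΦ.mono (hle _ (by simp)) le_rfl) hc (k := fun c h => eExp (ENNReal.ofReal (c * h)))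
      (measurable_eExp.comp (measurable_fst.mul measurable_snd).ennreal_ofReal)
    rw [hN.fading_law] at this
    refine Eq.trans (lintegral_congr fun ω => ?_) (this.trans (lintegral_congr fun ω => ?_))
    · congr 3
      simp only [emitted, hδ]
      ring
    · rw [lintegral_eExp_expMeasure]
      have := A.antenna_nonneg (N.angle a.1 a.2 ω)
      have := hl0 ω
      have := hδ0 (N.isOn a.1 a.2 ω)
      positivity
  -- the angle
  have h2 : ∫⁻ ω, Φ ω * ENNReal.ofReal (1 / (1 + t * l ω * A.power a.1 *
        A.antenna (N.angle a.1 a.2 ω) * δ (N.isOn a.1 a.2 ω))) ∂P =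
      ∫⁻ ω, Φ ω * (fun (c : ℝ) (b : Bool) => ENNReal.ofReal (A.halfBeam / Real.pi) *
          ENNReal.ofReal (1 / (1 + t * c * A.power a.1 * A.mainGain * δ b)) +
        ENNReal.ofReal ((Real.pi - A.halfBeam) / Real.pi) *
          ENNReal.ofReal (1 / (1 + t * c * A.power a.1 * A.sideGain * δ b)))
        (l ω) (N.isOn a.1 a.2 ω) ∂P := by
    have hind := hN.indep_source (.inr (.inr (.inl a)))
    have hc : Measurable[⨆ i ∈ ({.inr (.inr (.inl a))}ᶜ : Set _), N.sources i] fun ω =>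
        (l ω, δ (N.isOn a.1 a.2 ω)) :=
      (hl.mono (hle _ (by simp)) le_rfl).prodMk (hδm.comp
        ((comap_measurable (N.isOn a.1 a.2)).mono
          (hle' (.inr (.inr (.inl a))) (.inr (.inr (.inr a))) (by simp)) le_rfl))
    have hA := A.measurable_antenna
    have := lintegral_mul_comp_of_indep (hm _) (hN.measurable_angle a.1 a.2) hind
      (hΦ.mono (hle _ (by simp)) le_rfl) hc
      (k := fun c θ => ENNReal.ofReal (1 / (1 + t * c.1 * A.power a.1 * A.antenna θ * c.2)))
      (by unfold Function.uncurry; fun_prop)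
    rw [this]
    refine lintegral_congr fun ω => ?_
    rw [A.lintegral_antenna (hN.angle_law a.1 a.2) fun g =>
      ENNReal.ofReal (1 / (1 + t * l ω * A.power a.1 * g * δ (N.isOn a.1 a.2 ω)))]
  -- the activity
  have h3 := lintegral_mul_comp_of_indep (hm _) (hN.measurable_isOn a.1 a.2)
    (hN.indep_source (.inr (.inr (.inr a)))) (hΦ.mono (hle _ (by simp)) le_rfl)
    (hl.mono (hle _ (by simp)) le_rfl)
    (k := fun (c : ℝ) (b : Bool) => ENNReal.ofReal (A.halfBeam / Real.pi) *
          ENNReal.ofReal (1 / (1 + t * c * A.power a.1 * A.mainGain * δ b)) +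
        ENNReal.ofReal ((Real.pi - A.halfBeam) / Real.pi) *
          ENNReal.ofReal (1 / (1 + t * c * A.power a.1 * A.sideGain * δ b)))
    (by unfold Function.uncurry; fun_prop)
  rw [h1, h2, h3]
  refine lintegral_congr fun ω => ?_
  rw [A.lintegral_isOn (hN.measurable_isOn a.1 a.2) (hN.isOn_law a.1 a.2) (fun b => _)]
  have hl0 := hl0 ω
  have hb := A.halfBeam_nonneg
  have hb' := A.halfBeam_le
  have hpi := Real.pi_pos
  have hg1 := A.mainGain_nonneg
  have hg2 := A.sideGain_nonneg
  have ho := A.offProb_nonneg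
  have ho' : 0 ≤ 1 - A.offProb := sub_nonneg.2 A.offProb_le
  have hb'' : 0 ≤ (Real.pi - A.halfBeam) / Real.pi := div_nonneg (by linarith) hpi.le
  have hq (b : Bool) := hδ0 b
  have key (b : Bool) : ENNReal.ofReal (A.halfBeam / Real.pi) *
          ENNReal.ofReal (1 / (1 + t * l ω * A.power a.1 * A.mainGain * δ b)) +
        ENNReal.ofReal ((Real.pi - A.halfBeam) / Real.pi) *
          ENNReal.ofReal (1 / (1 + t * l ω * A.power a.1 * A.sideGain * δ b)) =
      ENNReal.ofReal (A.halfBeam / Real.pi * (1 / (1 + t * l ω * A.power a.1 * A.mainGain * δ b)) +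
        (Real.pi - A.halfBeam) / Real.pi *
          (1 / (1 + t * l ω * A.power a.1 * A.sideGain * δ b))) := by
    have := hδ0 b
    rw [← ENNReal.ofReal_mul (by positivity), ← ENNReal.ofReal_mul (by positivity),
      ← ENNReal.ofReal_add (by positivity) (by positivity)]
  have hnn (b : Bool) : 0 ≤ A.halfBeam / Real.pi *
      (1 / (1 + t * l ω * A.power a.1 * A.mainGain * δ b)) +
        (Real.pi - A.halfBeam) / Real.pi *
          (1 / (1 + t * l ω * A.power a.1 * A.sideGain * δ b)) := by
    have := hδ0 b
    positivity
  rw [key, key, ← ENNReal.ofReal_mul ho, ← ENNReal.ofReal_mul ho',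
    ← ENNReal.ofReal_add (mul_nonneg ho (hnn _)) (mul_nonneg ho' (hnn _))]
  congr 2
  have e1 : δ false = 0 := by simp [hδ]
  have e2 : δ true = 1 := by simp [hδ]
  rw [e1, e2, Params.mixture]
  field_simp
  ring

/-- Integrating out the marks of finitely many base stations. -/
lemma HasLaw.lintegral_mul_prod_eExp_emitted [IsProbabilityMeasure P] (hN : N.HasLaw A P)
    (F : Finset (Fin M × ℕ)) {l : Fin M × ℕ → Ω → ℝ} (hl : ∀ a, Measurable[N.siteAlg] (l a))
    (hl0 : ∀ a ω, 0 ≤ l a ω) {t : ℝ} (ht : 0 ≤ t) {Φ : Ω → ℝ≥0∞} (hΦ : Measurable[N.siteAlg] Φ) :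
    ∫⁻ ω, Φ ω * ∏ a ∈ F, eExp (ENNReal.ofReal (t * (l a ω * N.emitted A a.1 a.2 ω))) ∂P =
      ∫⁻ ω, Φ ω * ∏ a ∈ F, ENNReal.ofReal (A.mixture t (l a ω) a.1) ∂P := by
  induction F using Finset.induction_on generalizing Φ with
  | empty => simp
  | insert a F ha ih =>
    simp_rw [Finset.prod_insert ha]
    have hsite : N.siteAlg ≤ N.othersAlg a := siteAlg_le_othersAlg _
    have hmeas : Measurable[N.othersAlg a] fun ω =>
        Φ ω * ∏ b ∈ F, eExp (ENNReal.ofReal (t * (l b ω * N.emitted A b.1 b.2 ω))) := by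
      refine (hΦ.mono hsite le_rfl).mul (Finset.measurable_fun_prod _ fun b hb => ?_)
      refine measurable_eExp.comp (Measurable.ennreal_ofReal (Measurable.const_mul
        (((hl b).mono hsite le_rfl).mul (measurable_emitted_othersAlg ?_)) t))
      rintro rfl
      exact ha hb
    have hmix : Measurable[N.siteAlg] fun ω => ENNReal.ofReal (A.mixture t (l a ω) a.1) :=
      ((A.measurable_mixture t a.1).comp (hl a)).ennreal_ofReal
    calc _ = ∫⁻ ω, (Φ ω * ∏ b ∈ F, eExp (ENNReal.ofReal (t * (l b ω * N.emitted A b.1 b.2 ω)))) *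
          eExp (ENNReal.ofReal (t * (l a ω * N.emitted A a.1 a.2 ω))) ∂P :=
          lintegral_congr fun ω => by ring
      _ = _ := hN.lintegral_mul_eExp_emitted a hmeas ((hl a).mono hsite le_rfl) (hl0 a) ht
      _ = ∫⁻ ω, (Φ ω * ENNReal.ofReal (A.mixture t (l a ω) a.1)) *
          ∏ b ∈ F, eExp (ENNReal.ofReal (t * (l b ω * N.emitted A b.1 b.2 ω))) ∂P :=
          lintegral_congr fun ω => by ring
      _ = _ := ih (hΦ.mul hmix)
      _ = _ := lintegral_congr fun ω => by ring

end Network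

/-! ### Integrating out the link types -/

/-- Integrating an `m`-measurable function over `D` replaces `D` by its conditional probability
given `m`. -/
lemma setLIntegral_of_condExp_indicator {Ω : Type*} {m mΩ : MeasurableSpace Ω} {P : Measure Ω}
    [IsProbabilityMeasure P] (hm : m ≤ mΩ) {D : Set Ω} (hD : MeasurableSet D) {q : Ω → ℝ}
    (hq : P⟦D | m⟧ =ᵐ[P] q) (hqm : Measurable[m] q) (hq0 : ∀ ω, 0 ≤ q ω) {F : Ω → ℝ≥0∞}
    (hF : Measurable[m] F) :
    ∫⁻ ω in D, F ω ∂P = ∫⁻ ω, ENNReal.ofReal (q ω) * F ω ∂P := by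
  have hqm' : Measurable q := hqm.mono hm le_rfl
  have hint : Integrable q P := integrable_condExp.congr hq
  have hmeas : (P.restrict D).trim hm = (P.withDensity fun ω => ENNReal.ofReal (q ω)).trim hm := by
    refine @Measure.ext _ m _ _ fun S hS => ?_
    have hS' : MeasurableSet S := hm S hS
    rw [trim_measurableSet_eq hm hS, trim_measurableSet_eq hm hS, Measure.restrict_apply hS',
      withDensity_apply _ hS', ← ofReal_integral_eq_lintegral_ofReal hint.integrableOn
        (Filter.Eventually.of_forall hq0)]
    have h1 : ∫ ω in S, q ω ∂P = ∫ ω in S, D.indicator (fun _ => (1 : ℝ)) ω ∂P := by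
      rw [← setIntegral_condExp hm ((integrable_const (1 : ℝ)).indicator hD) hS]
      exact (setIntegral_congr_ae hS' (hq.mono fun ω h _ => h)).symm
    rw [h1, setIntegral_indicator hD, setIntegral_const, smul_eq_mul, mul_one,
      ofReal_measureReal]
  have hF' : Measurable F := hF.mono hm le_rfl
  calc ∫⁻ ω in D, F ω ∂P = ∫⁻ ω, F ω ∂(P.restrict D).trim hm := (lintegral_trim hm hF).symm
    _ = ∫⁻ ω, F ω ∂(P.withDensity fun ω => ENNReal.ofReal (q ω)) := by
        rw [hmeas, lintegral_trim hm hF]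
    _ = _ := lintegral_withDensity_eq_lintegral_mul _ hqm'.ennreal_ofReal hF'

lemma tendsto_lintegral_mul_prod_eExp {Ω : Type*} [MeasurableSpace Ω] {P : Measure Ω}
    [IsProbabilityMeasure P] {c : Ω → ℝ≥0∞} (hc : Measurable c) (hc1 : ∀ ω, c ω ≤ 1)
    {f : ℕ → Ω → ℝ≥0∞} (hf : ∀ j, Measurable (f j)) :
    Filter.Tendsto (fun n => ∫⁻ ω, c ω * ∏ j ∈ Finset.range n, eExp (f j ω) ∂P) Filter.atTop
      (nhds (∫⁻ ω, c ω * eExp (∑' j, f j ω) ∂P)) := by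
  have hanti (ω : Ω) : Antitone fun n => ∏ j ∈ Finset.range n, eExp (f j ω) := by
    refine antitone_nat_of_succ_le fun n => ?_
    rw [Finset.prod_range_succ]
    exact mul_le_of_le_one_right' (eExp_le_one _)
  refine lintegral_tendsto_of_tendsto_of_antitone (fun n => ?_)
    (Filter.Eventually.of_forall fun ω m n hmn => mul_le_mul_right (hanti ω hmn) _) ?_
    (Filter.Eventually.of_forall fun ω => ?_)
  · exact (hc.mul (Finset.measurable_fun_prod _ fun j _ =>
      measurable_eExp.comp (hf j))).aemeasurable
  · refine ne_top_of_le_ne_top ENNReal.one_ne_top ?_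
    calc _ ≤ ∫⁻ _, 1 ∂P := lintegral_mono fun ω => by simpa using hc1 ω
      _ = 1 := by simp
  · rw [eExp_tsum]
    exact ENNReal.Tendsto.const_mul (tendsto_atTop_iInf (hanti ω))
      (Or.inr (ne_top_of_le_ne_top ENNReal.one_ne_top (hc1 ω)))

lemma LinkType.univ_eq : (Finset.univ : Finset LinkType) = {.LOS, .NLOS} := rfl

lemma LinkType.sum_univ {β : Type*} [AddCommMonoid β] (f : LinkType → β) :
    ∑ p, f p = f .LOS + f .NLOS := by
  rw [LinkType.univ_eq, Finset.sum_pair (by decide)]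

namespace Params

variable {M : ℕ} (A : Params M)

lemma linkProb_nonneg (p : LinkType) {r : ℝ} (hr : 0 ≤ r) : 0 ≤ A.linkProb p r := by
  cases p
  · exact (Real.exp_pos _).le
  · have : Real.exp (-A.blocking * r) ≤ 1 := by
      rw [Real.exp_le_one_iff]; nlinarith [A.blocking_nonneg]
    simpa [linkProb] using this

lemma measurable_linkProb (p : LinkType) : Measurable (A.linkProb p) := by
  cases p <;> unfold linkProb <;> fun_prop

lemma sum_ofReal_linkProb {r : ℝ} (hr : 0 ≤ r) : ∑ p, ENNReal.ofReal (A.linkProb p r) = 1 := by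
  rw [LinkType.sum_univ, ← ENNReal.ofReal_add (A.linkProb_nonneg _ hr) (A.linkProb_nonneg _ hr)]
  simp [linkProb]

lemma ofReal_linkProb_le_one (p : LinkType) {r : ℝ} (hr : 0 ≤ r) :
    ENNReal.ofReal (A.linkProb p r) ≤ 1 := by
  rw [← A.sum_ofReal_linkProb hr]
  exact Finset.single_le_sum (f := fun p => ENNReal.ofReal (A.linkProb p r))
    (fun _ _ => zero_le) (Finset.mem_univ p)

/-- The product of the mixture factors of the operators in `Q`, at path loss `l`. -/
noncomputable def mixtureProd (Q : Finset (Fin M)) (t l : ℝ) : ℝ≥0∞ :=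
  ∏ m ∈ Q, ENNReal.ofReal (A.mixture t l m)

lemma measurable_mixtureProd (Q : Finset (Fin M)) (t : ℝ) : Measurable (A.mixtureProd Q t) :=
  Finset.measurable_fun_prod _ fun m _ => (A.measurable_mixture t m).ennreal_ofReal

lemma mixtureProd_le_one (Q : Finset (Fin M)) {t l : ℝ} (ht : 0 ≤ t) (hl : 0 ≤ l) :
    A.mixtureProd Q t l ≤ 1 :=
  Finset.prod_le_one' fun m _ => ENNReal.ofReal_le_one.2 (A.mixture_le_one ht hl m)

/-- The factor contributed by a site at `y`, averaged over its link type and marks. A link type with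
path loss above `r` contributes zero, every other one the Laplace transform at `t` of the
interference from the operators in `Q`. -/
noncomputable def siteFactor (Q : Finset (Fin M)) (t r : ℝ) (y : Plane) : ℝ≥0∞ :=
  ∑ p, ENNReal.ofReal (A.linkProb p ‖y‖) *
    if A.pathLoss p ‖y‖ ≤ r then A.mixtureProd Q t (A.pathLoss p ‖y‖) else 0

lemma measurable_siteFactor_comp {α : Type*} {_ : MeasurableSpace α} (Q : Finset (Fin M)) (t : ℝ)
    {r : α → ℝ} (hr : Measurable r) {y : α → Plane} (hy : Measurable y) :
    Measurable fun a => A.siteFactor Q t (r a) (y a) := by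
  have hl (p : LinkType) : Measurable fun a => A.pathLoss p ‖y a‖ :=
    (A.measurable_pathLoss p).comp hy.norm
  refine Finset.measurable_fun_sum _ fun p _ => Measurable.mul ?_ (Measurable.ite ?_ ?_ ?_)
  · exact ((A.measurable_linkProb p).comp hy.norm).ennreal_ofReal
  · exact measurableSet_le (hl p) hr
  · exact (A.measurable_mixtureProd Q t).comp (hl p)
  · exact measurable_const

lemma siteFactor_le_one (Q : Finset (Fin M)) {t : ℝ} (ht : 0 ≤ t) (r : ℝ) (y : Plane) :
    A.siteFactor Q t r y ≤ 1 := by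
  rw [← A.sum_ofReal_linkProb (norm_nonneg y)]
  refine Finset.sum_le_sum fun p _ => mul_le_of_le_one_right' ?_
  split_ifs
  · exact A.mixtureProd_le_one Q ht (A.pathLoss_nonneg p (norm_nonneg y))
  · exact zero_le

lemma siteFactor_mono (Q : Finset (Fin M)) (t : ℝ) (y : Plane) :
    Monotone fun r => A.siteFactor Q t r y := by
  intro r r' h
  refine Finset.sum_le_sum fun p _ => mul_le_mul_right ?_ _
  split_ifs with h1 h2
  · exact le_rfl
  · exact absurd (h1.trans h) h2
  · exact zero_le
  · exact le_rfl

/-- As a function of the threshold `r`, the site factor is a step function that is continuous from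
the right. -/
lemma eventually_siteFactor_eq (Q : Finset (Fin M)) (t r : ℝ) (y : Plane) :
    ∀ᶠ r' in nhdsWithin r (Set.Ioi r), A.siteFactor Q t r' y = A.siteFactor Q t r y := by
  have h (p : LinkType) : ∀ᶠ r' in nhdsWithin r (Set.Ioi r),
      (A.pathLoss p ‖y‖ ≤ r' ↔ A.pathLoss p ‖y‖ ≤ r) := by
    by_cases hp : A.pathLoss p ‖y‖ ≤ r
    · filter_upwards [self_mem_nhdsWithin] with r' hr'
      simp [hp, hp.trans (le_of_lt hr')]
    · filter_upwards [mem_nhdsWithin_of_mem_nhds (Iio_mem_nhds (not_le.1 hp))] with r' hr'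
      simp [hp, not_le.2 (Set.mem_Iio.1 hr')]
  filter_upwards [h .LOS, h .NLOS] with r' h1 h2
  simp only [siteFactor, LinkType.sum_univ, h1, h2]

end Params

namespace Network

variable {Ω : Type*} {M : ℕ} (N : Network Ω M)

/-- The σ-algebra of the sites. -/
abbrev locAlg : MeasurableSpace Ω :=
  MeasurableSpace.comap (fun ω (j : ℕ) => N.loc j ω) inferInstance

variable {N}

lemma measurable_loc_locAlg (j : ℕ) : Measurable[N.locAlg] (N.loc j) :=
  (measurable_pi_apply j).comp (comap_measurable fun ω (j : ℕ) => N.loc j ω)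

lemma measurable_comp_siteAlg {β : Type*} [MeasurableSpace β] {g : LinkType → Plane → β}
    (hg : ∀ p, Measurable (g p)) (j : ℕ) :
    Measurable[N.siteAlg] fun ω => g (N.link j ω) (N.loc j ω) := by
  have h1 : Measurable fun q : LinkType × Plane => g q.1 q.2 :=
    measurable_from_prod_countable_right hg
  have h2 : Measurable[N.siteAlg] fun ω => (N.loc j ω, N.link j ω) :=
    (measurable_pi_apply j).comp (comap_measurable fun ω (j : ℕ) => (N.loc j ω, N.link j ω))
  exact h1.comp ((measurable_snd.comp h2).prodMk (measurable_fst.comp h2))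

variable [mΩ : MeasurableSpace Ω] {A : Params M} {P : Measure Ω}

lemma HasLaw.locAlg_le (hN : N.HasLaw A P) : N.locAlg ≤ mΩ :=
  (measurable_pi_lambda _ hN.loc_poisson.measurable).comap_le

/-- Given the sites, the link types of finitely many sites can be averaged separately. -/
lemma HasLaw.lintegral_prod_link [IsProbabilityMeasure P] (hN : N.HasLaw A P) (J : Finset ℕ)
    {f : ℕ → LinkType → Ω → ℝ≥0∞} (hf : ∀ j p, Measurable[N.locAlg] (f j p)) :
    ∫⁻ ω, ∏ j ∈ J, f j (N.link j ω) ω ∂P =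
      ∫⁻ ω, ∏ j ∈ J, ∑ p, ENNReal.ofReal (A.linkProb p ‖N.loc j ω‖) * f j p ω ∂P := by
  classical
  let ext : (J → LinkType) → ℕ → LinkType := fun τ j => if h : j ∈ J then τ ⟨j, h⟩ else .LOS
  let D : (J → LinkType) → Set Ω := fun τ => {ω | ∀ j ∈ J, N.link j ω = ext τ j}
  have hext (τ : J → LinkType) (j : J) : ext τ j = τ j := by simp [ext]
  have hDmem (τ : J → LinkType) (ω : Ω) : ω ∈ D τ ↔ (fun j : J => N.link j ω) = τ := by
    constructor
    · intro h; ext1 j; rw [← hext τ]; exact h j j.2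
    · rintro rfl j hj; simp [ext, hj]
  have hDm (τ : J → LinkType) : MeasurableSet (D τ) := by
    have : D τ = ⋂ j ∈ J, {ω | N.link j ω = ext τ j} := by ext ω; simp [D]
    rw [this]
    exact Finset.measurableSet_biInter _ fun j _ =>
      hN.measurable_link j (measurableSet_singleton _)
  have hFm (τ : J → LinkType) : Measurable[N.locAlg] fun ω => ∏ j : J, f j (τ j) ω :=
    Finset.measurable_fun_prod _ fun j _ => hf _ _
  have hL (ω : Ω) : ∏ j ∈ J, f j (N.link j ω) ω =
      ∑ τ : J → LinkType, (D τ).indicator (fun ω => ∏ j : J, f j (τ j) ω) ω := by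
    rw [Finset.sum_eq_single (fun j : J => N.link j ω)]
    · rw [Set.indicator_of_mem ((hDmem _ _).2 rfl)]
      exact (Finset.prod_coe_sort J fun j => f j (N.link j ω) ω).symm
    · intro τ _ hτ
      exact Set.indicator_of_notMem (fun h => hτ ((hDmem _ _).1 h).symm) _
    · simp
  have hR (ω : Ω) : ∏ j ∈ J, ∑ p, ENNReal.ofReal (A.linkProb p ‖N.loc j ω‖) * f j p ω =
      ∑ τ : J → LinkType, ENNReal.ofReal (∏ j ∈ J, A.linkProb (ext τ j) ‖N.loc j ω‖) *
        ∏ j : J, f j (τ j) ω := by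
    rw [← Finset.prod_coe_sort J fun j =>
      ∑ p, ENNReal.ofReal (A.linkProb p ‖N.loc j ω‖) * f j p ω, Finset.prod_univ_sum,
      Fintype.piFinset_univ]
    refine Finset.sum_congr rfl fun τ _ => ?_
    rw [Finset.prod_mul_distrib,
      ENNReal.ofReal_prod_of_nonneg fun j _ => A.linkProb_nonneg _ (norm_nonneg _),
      ← Finset.prod_coe_sort J]
    simp_rw [hext]
  have hqm (τ : J → LinkType) :
      Measurable[N.locAlg] fun ω => ∏ j ∈ J, A.linkProb (ext τ j) ‖N.loc j ω‖ :=
    Finset.measurable_fun_prod _ fun j _ =>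
      (A.measurable_linkProb _).comp (measurable_norm.comp (measurable_loc_locAlg j))
  simp_rw [hL, hR]
  rw [lintegral_finsetSum _ fun τ _ => ((hFm τ).mono hN.locAlg_le le_rfl).indicator (hDm τ),
    lintegral_finsetSum (f := fun τ ω => ENNReal.ofReal
      (∏ j ∈ J, A.linkProb (ext τ j) ‖N.loc j ω‖) * ∏ j : J, f j (τ j) ω) _
      fun τ _ => (((hqm τ).mono hN.locAlg_le le_rfl).ennreal_ofReal).mul
      ((hFm τ).mono hN.locAlg_le le_rfl)]
  refine Finset.sum_congr rfl fun τ _ => ?_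
  rw [lintegral_indicator (hDm τ)]
  exact setLIntegral_of_condExp_indicator hN.locAlg_le (hDm τ) (hN.link_law J (ext τ)) (hqm τ)
    (fun ω => Finset.prod_nonneg fun j _ => A.linkProb_nonneg _ (norm_nonneg _)) (hFm τ)

end Network

/-! ### The joint law of the strongest site and its interference -/

namespace Network

variable {Ω : Type*} {M : ℕ} (N : Network Ω M) (A : Params M)

/-- Path loss of the link from site `j` to the typical user. -/
noncomputable def siteLoss (j : ℕ) (ω : Ω) : ℝ := A.pathLoss (N.link j ω) ‖N.loc j ω‖

/-- `t` times the interference from the operators in `Q` at site `j`, or `∞` if the path loss of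
site `j` exceeds that of site `i`. The value `∞` turns the event that site `i` is a strongest one
into a factor `exp (-exponent)` for each other site. -/
noncomputable def exponent (Q : Finset (Fin M)) (t : ℝ) (i j : ℕ) (ω : Ω) : ℝ≥0∞ :=
  if N.siteLoss A j ω ≤ N.siteLoss A i ω then
    ∑ m ∈ Q, ENNReal.ofReal (t * (N.siteLoss A j ω * N.emitted A m j ω)) else ∞

variable {N}

lemma siteLoss_nonneg (j : ℕ) (ω : Ω) : 0 ≤ N.siteLoss A j ω :=
  A.pathLoss_nonneg _ (norm_nonneg _)

lemma measurable_siteLoss_siteAlg (j : ℕ) : Measurable[N.siteAlg] (N.siteLoss A j) :=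
  measurable_comp_siteAlg (g := fun p y => A.pathLoss p ‖y‖)
    (fun p => (A.measurable_pathLoss p).comp measurable_norm) j

variable {A} [mΩ : MeasurableSpace Ω] {P : Measure Ω}

lemma HasLaw.measurable_emitted (hN : N.HasLaw A P) (m : Fin M) (j : ℕ) :
    Measurable (N.emitted A m j) :=
  measurable_emitted_of_le (hN.measurable_fading m j) (hN.measurable_angle m j)
    (hN.measurable_isOn m j)

lemma HasLaw.measurable_siteLoss (hN : N.HasLaw A P) (j : ℕ) : Measurable (N.siteLoss A j) :=
  (measurable_siteLoss_siteAlg A j).mono hN.siteAlg_le le_rfl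

lemma HasLaw.measurable_exponent (hN : N.HasLaw A P) (Q : Finset (Fin M)) (t : ℝ) (i j : ℕ) :
    Measurable (N.exponent A Q t i j) :=
  Measurable.ite (measurableSet_le (hN.measurable_siteLoss j) (hN.measurable_siteLoss i))
    (Finset.measurable_fun_sum _ fun m _ =>
      (((hN.measurable_siteLoss j).mul (hN.measurable_emitted m j)).const_mul t).ennreal_ofReal)
    measurable_const

/-- Integrating out the marks and the link types of site `i` and finitely many other sites. -/
lemma HasLaw.lintegral_prod_exponent [IsProbabilityMeasure P] (hN : N.HasLaw A P)
    (Q : Finset (Fin M)) (n : Fin M) {t : ℝ} (ht : 0 ≤ t) {u : LinkType → Plane → ℝ≥0∞}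
    (hu : ∀ p, Measurable (u p)) {i : ℕ} {J : Finset ℕ} (hi : i ∉ J) :
    ∫⁻ ω, u (N.link i ω) (N.loc i ω) *
        eExp (∑ m ∈ Q.erase n, ENNReal.ofReal (t * (N.siteLoss A i ω * N.emitted A m i ω))) *
        ∏ j ∈ J, eExp (N.exponent A Q t i j ω) ∂P =
      ∑ s, ∫⁻ ω, ENNReal.ofReal (A.linkProb s ‖N.loc i ω‖) * (u s (N.loc i ω) *
        A.mixtureProd (Q.erase n) t (A.pathLoss s ‖N.loc i ω‖)) *
        ∏ j ∈ J, A.siteFactor Q t (A.pathLoss s ‖N.loc i ω‖) (N.loc j ω) ∂P := by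
  classical
  set R := N.siteLoss A
  -- the marks
  let F : Finset (Fin M × ℕ) := (Q.erase n) ×ˢ {i} ∪ Q ×ˢ J
  have hprod (g : Fin M × ℕ → ℝ≥0∞) :
      ∏ a ∈ F, g a = (∏ m ∈ Q.erase n, g (m, i)) * ∏ j ∈ J, ∏ m ∈ Q, g (m, j) := by
    rw [Finset.prod_union, Finset.prod_product, Finset.prod_product_right]
    · simp
    · rw [Finset.disjoint_left]
      rintro ⟨m, j⟩ h1 h2
      simp only [Finset.mem_product, Finset.mem_singleton] at h1 h2
      exact hi (h1.2 ▸ h2.2)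
  let Φ : Ω → ℝ≥0∞ := fun ω =>
    u (N.link i ω) (N.loc i ω) * ∏ j ∈ J, if R j ω ≤ R i ω then 1 else 0
  have hRm (j : ℕ) : Measurable[N.siteAlg] (R j) := measurable_siteLoss_siteAlg A j
  have hΦ : Measurable[N.siteAlg] Φ := by
    refine (measurable_comp_siteAlg hu i).mul (Finset.measurable_fun_prod _ fun j _ => ?_)
    exact Measurable.ite (measurableSet_le (hRm j) (hRm i))
      measurable_const measurable_const
  have h1 : ∫⁻ ω, u (N.link i ω) (N.loc i ω) *
        eExp (∑ m ∈ Q.erase n, ENNReal.ofReal (t * (R i ω * N.emitted A m i ω))) *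
        ∏ j ∈ J, eExp (N.exponent A Q t i j ω) ∂P =
      ∫⁻ ω, u (N.link i ω) (N.loc i ω) * A.mixtureProd (Q.erase n) t (R i ω) *
        ∏ j ∈ J, (if R j ω ≤ R i ω then A.mixtureProd Q t (R j ω) else 0) ∂P := by
    have h := hN.lintegral_mul_prod_eExp_emitted F (l := fun a => R a.2) (fun a => hRm a.2)
      (fun a ω => siteLoss_nonneg A a.2 ω) ht hΦ
    refine Eq.trans (lintegral_congr fun ω => ?_) (h.trans (lintegral_congr fun ω => ?_))
    · have h2 : ∏ j ∈ J, eExp (N.exponent A Q t i j ω) =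
          (∏ j ∈ J, if R j ω ≤ R i ω then 1 else 0) *
            ∏ j ∈ J, ∏ m ∈ Q, eExp (ENNReal.ofReal (t * (R j ω * N.emitted A m j ω))) := by
        rw [← Finset.prod_mul_distrib]
        refine Finset.prod_congr rfl fun j _ => ?_
        unfold exponent
        split_ifs
        · rw [eExp_sum, one_mul]
        · rw [eExp_top, zero_mul]
      rw [hprod, h2, eExp_sum]
      simp only [Φ]
      ring
    · have h2 : ∏ j ∈ J, (if R j ω ≤ R i ω then A.mixtureProd Q t (R j ω) else 0) =
          (∏ j ∈ J, if R j ω ≤ R i ω then 1 else 0) * ∏ j ∈ J, A.mixtureProd Q t (R j ω) := by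
        rw [← Finset.prod_mul_distrib]
        refine Finset.prod_congr rfl fun j _ => ?_
        split_ifs <;> simp
      rw [hprod, h2]
      simp only [Φ, Params.mixtureProd]
      ring
  -- the link types, separately for each type `s` of site `i`
  let f : LinkType → ℕ → LinkType → Ω → ℝ≥0∞ := fun s j p ω =>
    if j = i then
      (if p = s then u s (N.loc i ω) *
        A.mixtureProd (Q.erase n) t (A.pathLoss s ‖N.loc i ω‖) else 0)
    else if A.pathLoss p ‖N.loc j ω‖ ≤ A.pathLoss s ‖N.loc i ω‖ then
      A.mixtureProd Q t (A.pathLoss p ‖N.loc j ω‖) else 0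
  have hpl (p : LinkType) (j : ℕ) : Measurable[N.locAlg] fun ω => A.pathLoss p ‖N.loc j ω‖ :=
    (A.measurable_pathLoss p).comp (measurable_norm.comp (measurable_loc_locAlg j))
  have hf (s : LinkType) (j : ℕ) (p : LinkType) : Measurable[N.locAlg] (f s j p) := by
    by_cases hj : j = i
    · by_cases hp : p = s
      · simp only [f, hj, hp, if_true]
        exact ((hu s).comp (measurable_loc_locAlg i)).mul
          ((A.measurable_mixtureProd _ t).comp (hpl s i))
      · simp only [f, hj, hp, if_true, if_false]
        exact measurable_const
    · simp only [f, hj, if_false]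
      exact Measurable.ite (measurableSet_le (hpl p j) (hpl s i))
        ((A.measurable_mixtureProd _ t).comp (hpl p j)) measurable_const
  have hne {j : ℕ} (hj : j ∈ J) : j ≠ i := fun h => hi (h ▸ hj)
  have h2 (ω : Ω) : u (N.link i ω) (N.loc i ω) * A.mixtureProd (Q.erase n) t (R i ω) *
        ∏ j ∈ J, (if R j ω ≤ R i ω then A.mixtureProd Q t (R j ω) else 0) =
      ∑ s, ∏ j ∈ insert i J, f s j (N.link j ω) ω := by
    rw [Finset.sum_eq_single (N.link i ω)]
    · rw [Finset.prod_insert hi]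
      congr 1
      · simp only [f, if_true]; rfl
      · refine Finset.prod_congr rfl fun j hj => ?_
        simp only [f, hne hj, if_false]; rfl
    · intro s _ hs
      rw [Finset.prod_insert hi]
      simp only [f, if_true, if_neg hs.symm, zero_mul]
    · simp
  have hfm (s : LinkType) : Measurable fun ω => ∏ j ∈ insert i J, f s j (N.link j ω) ω := by
    refine Finset.measurable_fun_prod _ fun j _ => ?_
    have : Measurable fun q : LinkType × Ω => f s j q.1 q.2 :=
      measurable_from_prod_countable_right fun p => (hf s j p).mono hN.locAlg_le le_rfl
    exact this.comp ((hN.measurable_link j).prodMk measurable_id)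
  rw [h1]
  simp_rw [h2]
  rw [lintegral_finsetSum _ fun s _ => hfm s]
  refine Finset.sum_congr rfl fun s _ => ?_
  rw [hN.lintegral_prod_link _ (hf s)]
  refine lintegral_congr fun ω => ?_
  rw [Finset.prod_insert hi]
  congr 1
  · rw [Finset.sum_eq_single s]
    · simp only [f, if_true]
    · intro p _ hp
      simp only [f, if_true, if_neg hp, mul_zero]
    · simp
  · refine Finset.prod_congr rfl fun j hj => ?_
    simp only [f, hne hj, if_false]
    rfl

/-- Integrating out the marks and the link types of all sites, for a fixed site `i`. -/
lemma HasLaw.lintegral_eExp_tsum_exponent [IsProbabilityMeasure P] (hN : N.HasLaw A P)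
    (Q : Finset (Fin M)) (n : Fin M) {t : ℝ} (ht : 0 ≤ t) {u : LinkType → Plane → ℝ≥0∞}
    (hu : ∀ p, Measurable (u p)) (hu1 : ∀ p y, u p y ≤ 1) (i : ℕ) :
    ∫⁻ ω, u (N.link i ω) (N.loc i ω) *
        eExp (∑ m ∈ Q.erase n, ENNReal.ofReal (t * (N.siteLoss A i ω * N.emitted A m i ω))) *
        eExp (∑' j, if j = i then 0 else N.exponent A Q t i j ω) ∂P =
      ∑ s, ∫⁻ ω, ENNReal.ofReal (A.linkProb s ‖N.loc i ω‖) * (u s (N.loc i ω) *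
        A.mixtureProd (Q.erase n) t (A.pathLoss s ‖N.loc i ω‖)) *
        eExp (∑' j, if j = i then 0 else
          negLog (A.siteFactor Q t (A.pathLoss s ‖N.loc i ω‖) (N.loc j ω))) ∂P := by
  have hloc := hN.loc_poisson.measurable
  have hprod (k : ℕ) (g : ℕ → ℝ≥0∞) : ∏ j ∈ Finset.range k, eExp (if j = i then 0 else g j) =
      ∏ j ∈ (Finset.range k).erase i, eExp (g j) := by
    rw [← Finset.prod_subset (Finset.erase_subset i (Finset.range k))]
    · exact Finset.prod_congr rfl fun j hj => by rw [if_neg (Finset.ne_of_mem_erase hj)]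
    · intro j hj hj'
      have : j = i := by
        by_contra h
        exact hj' (Finset.mem_erase.2 ⟨h, hj⟩)
      simp [this]
  have hpl (s : LinkType) : Measurable fun ω => A.pathLoss s ‖N.loc i ω‖ :=
    (A.measurable_pathLoss s).comp (hloc i).norm
  have hL := tendsto_lintegral_mul_prod_eExp (P := P)
    (c := fun ω => u (N.link i ω) (N.loc i ω) * eExp (∑ m ∈ Q.erase n,
      ENNReal.ofReal (t * (N.siteLoss A i ω * N.emitted A m i ω))))
    (f := fun j ω => if j = i then 0 else N.exponent A Q t i j ω)
    (((measurable_comp_siteAlg hu i).mono hN.siteAlg_le le_rfl).mul (measurable_eExp.comp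
      (Finset.measurable_fun_sum _ fun m _ => (((hN.measurable_siteLoss i).mul
        (hN.measurable_emitted m i)).const_mul t).ennreal_ofReal)))
    (fun ω => mul_le_one' (hu1 _ _) (eExp_le_one _))
    (fun j => by
      split_ifs
      · exact measurable_const
      · exact hN.measurable_exponent Q t i j)
  have hRt := tendsto_finsetSum (Finset.univ : Finset LinkType) fun s _ =>
    tendsto_lintegral_mul_prod_eExp (P := P)
    (c := fun ω => ENNReal.ofReal (A.linkProb s ‖N.loc i ω‖) * (u s (N.loc i ω) *
        A.mixtureProd (Q.erase n) t (A.pathLoss s ‖N.loc i ω‖)))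
    (f := fun j ω => if j = i then 0 else
          negLog (A.siteFactor Q t (A.pathLoss s ‖N.loc i ω‖) (N.loc j ω)))
    (((A.measurable_linkProb s).comp (hloc i).norm).ennreal_ofReal.mul
      (((hu s).comp (hloc i)).mul ((A.measurable_mixtureProd _ t).comp (hpl s))))
    (fun ω => mul_le_one' (A.ofReal_linkProb_le_one s (norm_nonneg _)) (mul_le_one' (hu1 _ _)
      (A.mixtureProd_le_one _ ht (A.pathLoss_nonneg s (norm_nonneg _)))))
    (fun j => by
      split_ifs
      · exact measurable_const
      · exact measurable_negLog.comp (A.measurable_siteFactor_comp Q t (hpl s) (hloc j)))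
  refine tendsto_nhds_unique hL (hRt.congr fun k => ?_)
  simp_rw [hprod, eExp_negLog (A.siteFactor_le_one Q ht _ _)]
  exact (hN.lintegral_prod_exponent Q n ht hu (Finset.notMem_erase i _)).symm

instance sigmaFinite_intensity (A : Params M) :
    SigmaFinite (ENNReal.ofReal A.density • (volume : Measure Plane)) :=
  inferInstanceAs (SigmaFinite (A.density.toNNReal • (volume : Measure Plane)))

/-- The joint law of type and location of a strongest site, weighted with the Laplace transform of
the interference. -/
theorem HasLaw.lintegral_tsum_strongest [IsProbabilityMeasure P] (hN : N.HasLaw A P)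
    (Q : Finset (Fin M)) (n : Fin M) {t : ℝ} (ht : 0 ≤ t) {u : LinkType → Plane → ℝ≥0∞}
    (hu : ∀ p, Measurable (u p)) (hu1 : ∀ p y, u p y ≤ 1) :
    ∑' i, ∫⁻ ω, u (N.link i ω) (N.loc i ω) *
        eExp (∑ m ∈ Q.erase n, ENNReal.ofReal (t * (N.siteLoss A i ω * N.emitted A m i ω))) *
        eExp (∑' j, if j = i then 0 else N.exponent A Q t i j ω) ∂P =
      ∑ s, ∫⁻ z, ENNReal.ofReal (A.linkProb s ‖z‖) * (u s z *
        A.mixtureProd (Q.erase n) t (A.pathLoss s ‖z‖)) *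
        eExp (∫⁻ y, (1 - A.siteFactor Q t (A.pathLoss s ‖z‖) y)
          ∂(ENNReal.ofReal A.density • volume)) ∂(ENNReal.ofReal A.density • volume) := by
  simp_rw [hN.lintegral_eExp_tsum_exponent Q n ht hu hu1]
  rw [Summable.tsum_finsetSum fun _ _ => ENNReal.summable]
  refine Finset.sum_congr rfl fun s _ => ?_
  have hpl : Measurable fun z : Plane => A.pathLoss s ‖z‖ :=
    (A.measurable_pathLoss s).comp measurable_norm
  have hv : Measurable fun z : Plane => ENNReal.ofReal (A.linkProb s ‖z‖) * (u s z *
      A.mixtureProd (Q.erase n) t (A.pathLoss s ‖z‖)) :=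
    ((A.measurable_linkProb s).comp measurable_norm).ennreal_ofReal.mul
      ((hu s).mul ((A.measurable_mixtureProd _ t).comp hpl))
  have hloc := hN.loc_poisson.measurable
  -- given type `s` at `z`, the site factor depends on `z` through the path loss only
  have h := hN.loc_poisson.meckeFormula_of_rightContinuous hpl
    (W := fun r y => negLog (A.siteFactor Q t r y))
    (fun r => measurable_negLog.comp
      (A.measurable_siteFactor_comp Q t measurable_const measurable_id))
    (fun y r r' hr => negLog_antitone (A.siteFactor_mono Q t y hr))
    (fun r y => tendsto_const_nhds.congr' ((A.eventually_siteFactor_eq Q t r y).mono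
      fun r' hr' => congrArg negLog hr'.symm)) hv
    (fun z => mul_le_one' (A.ofReal_linkProb_le_one s (norm_nonneg _)) (mul_le_one' (hu1 _ _)
      (A.mixtureProd_le_one _ ht (A.pathLoss_nonneg s (norm_nonneg _)))))
  unfold MeckeFormula at h
  simp_rw [eExp_negLog (A.siteFactor_le_one Q ht _ _)] at h
  rw [← h, lintegral_tsum]
  intro i
  refine ((hv.comp (hloc i)).mul (measurable_eExp.comp (Measurable.tsum fun j => ?_))).aemeasurable
  split_ifs
  · exact measurable_const
  · exact measurable_negLog.comp
      (A.measurable_siteFactor_comp Q t (hpl.comp (hloc i)) (hloc j))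

end Network

/-! ### Radial integrals in the plane and exclusion radii -/

/-- Polar coordinates for a radial function. -/
lemma lintegral_comp_norm_plane {h : ℝ → ℝ≥0∞} (hh : Measurable h) :
    ∫⁻ y : Plane, h ‖y‖ =
      ENNReal.ofReal (2 * Real.pi) * ∫⁻ r in Set.Ioi (0 : ℝ), ENNReal.ofReal r * h r := by
  have hfr : Module.finrank ℝ Plane = 2 := by simp
  have hball : (volume : Measure Plane).toSphere Set.univ = ENNReal.ofReal (2 * Real.pi) := by
    rw [Measure.toSphere_apply_univ, hfr, EuclideanSpace.volume_ball_fin_two,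
      ENNReal.ofReal_mul (by norm_num)]
    simp
  have hmp := (volume : Measure Plane).measurePreserving_homeomorphUnitSphereProd
  have hg : Measurable fun r : Set.Ioi (0 : ℝ) => h r := hh.comp measurable_subtype_coe
  calc ∫⁻ y : Plane, h ‖y‖ = ∫⁻ y in ({0}ᶜ : Set Plane), h ‖y‖ := by
        rw [restrict_compl_singleton]
    _ = ∫⁻ y : ({0}ᶜ : Set Plane), h ‖y.1‖ ∂(volume.comap Subtype.val) :=
        (lintegral_subtype_comap (measurableSet_singleton _).compl fun y : Plane => h ‖y‖).symm
    _ = ∫⁻ x, h x.2 ∂(volume : Measure Plane).toSphere.prod (.volumeIoiPow 1) := by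
        have := hmp.lintegral_comp_emb (Homeomorph.measurableEmbedding _)
          (fun x : Metric.sphere (0 : Plane) 1 × Set.Ioi (0 : ℝ) => h x.2)
        rw [hfr] at this
        rw [← this]
        simp
    _ = (∫⁻ r : Set.Ioi (0 : ℝ), h r ∂(.volumeIoiPow 1)) * ENNReal.ofReal (2 * Real.pi) := by
        rw [lintegral_prod (fun x : Metric.sphere (0 : Plane) 1 × Set.Ioi (0 : ℝ) => h x.2)
          (hg.comp measurable_snd).aemeasurable]
        simp only [lintegral_const, hball]
    _ = _ := by
        rw [mul_comm, Measure.volumeIoiPow, lintegral_withDensity_eq_lintegral_mul _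
          (by fun_prop) hg, ← lintegral_subtype_comap measurableSet_Ioi]
        simp

namespace Params

variable {M : ℕ} (A : Params M)

lemma exclusionRadius_pos (s p : LinkType) {x : ℝ} (hx : 0 < x) : 0 < A.exclusionRadius s p x := by
  have := A.pathGain_pos s
  have := A.pathGain_pos p
  unfold exclusionRadius
  positivity

lemma pathLoss_lt_iff (p : LinkType) {r r' : ℝ} (hr : 0 < r) (hr' : 0 < r') :
    A.pathLoss p r < A.pathLoss p r' ↔ r' < r := by
  unfold pathLoss
  rw [mul_lt_mul_iff_right₀ (A.pathGain_pos p)]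
  exact Real.rpow_lt_rpow_iff_of_neg hr hr' (neg_lt_zero.2 (A.pathExp_pos p))

lemma pathLoss_exclusionRadius (s p : LinkType) {x : ℝ} (hx : 0 < x) :
    A.pathLoss p (A.exclusionRadius s p x) = A.pathLoss s x := by
  have h1 := A.pathGain_pos s
  have h2 := A.pathGain_pos p
  have h3 := (A.pathExp_pos p).ne'
  have h4 : 0 < A.pathGain p / A.pathGain s := by positivity
  unfold pathLoss exclusionRadius
  rw [Real.mul_rpow (by positivity) (by positivity), ← Real.rpow_mul h4.le, ← Real.rpow_mul hx.le]
  have e1 : 1 / A.pathExp p * -A.pathExp p = -1 := by field_simp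
  have e2 : A.pathExp s / A.pathExp p * -A.pathExp p = -A.pathExp s := by field_simp
  rw [e1, e2, Real.rpow_neg_one]
  field_simp

lemma pathLoss_le_iff (s p : LinkType) {x y : ℝ} (hx : 0 < x) (hy : 0 < y) :
    A.pathLoss p y ≤ A.pathLoss s x ↔ A.exclusionRadius s p x ≤ y := by
  rw [← A.pathLoss_exclusionRadius s p hx, ← not_lt,
    A.pathLoss_lt_iff p (A.exclusionRadius_pos s p hx) hy, not_lt]

lemma measurable_exclusionRadius (s p : LinkType) : Measurable (A.exclusionRadius s p) := by
  unfold exclusionRadius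
  fun_prop

end Params

/-! ### Existence and uniqueness of the serving site -/

namespace Network

variable {Ω : Type*} {M : ℕ} {N : Network Ω M} {A : Params M}

lemma isServing_iff {n : Fin M} {ω : Ω} {i : ℕ} :
    N.IsServing A n ω i ↔ ∀ j, j ≠ i → N.siteLoss A j ω < N.siteLoss A i ω := by
  simp only [IsServing, avgPower, siteLoss, mul_lt_mul_iff_right₀ (A.power_pos n)]

lemma IsServing.unique {n : Fin M} {ω : Ω} {i i' : ℕ} (h : N.IsServing A n ω i)
    (h' : N.IsServing A n ω i') : i = i' := by
  by_contra hne
  exact lt_asymm (h i' (Ne.symm hne)) (h' i hne)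

lemma IsServing.serving_eq {n : Fin M} {ω : Ω} {i : ℕ} (h : N.IsServing A n ω i) :
    N.serving A n ω = i := by
  have : {i | N.IsServing A n ω i} = {i} := by
    ext i'
    exact ⟨fun h' => h'.unique h, fun h' => by rw [Set.mem_singleton_iff.1 h']; exact h⟩
  rw [serving, this, csInf_singleton]

/-- A site of largest path loss exists as soon as the sites are locally finite and avoid the
origin. -/
lemma exists_forall_siteLoss_le {ω : Ω} (h0 : ∀ j, N.loc j ω ≠ 0)
    (hfin : ∀ k : ℕ, {j | N.loc j ω ∈ Metric.ball 0 (k : ℝ)}.Finite) :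
    ∃ i, ∀ j, N.siteLoss A j ω ≤ N.siteLoss A i ω := by
  have hpos (j : ℕ) : 0 < ‖N.loc j ω‖ := norm_pos_iff.2 (h0 j)
  -- every site at least as strong as site `0` lies within the larger one of two radii
  set D : LinkType → ℝ := fun p => A.exclusionRadius (N.link 0 ω) p ‖N.loc 0 ω‖
  obtain ⟨k, hk⟩ := exists_nat_gt (max (D .LOS) (D .NLOS))
  have hsub : {j | N.siteLoss A 0 ω ≤ N.siteLoss A j ω} ⊆
      {j | N.loc j ω ∈ Metric.ball 0 (k : ℝ)} := by
    intro j hj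
    have hj' : A.pathLoss (N.link 0 ω) ‖N.loc 0 ω‖ ≤ A.pathLoss (N.link j ω) ‖N.loc j ω‖ := hj
    rw [← A.pathLoss_exclusionRadius _ (N.link j ω) (hpos 0), ← not_lt,
      A.pathLoss_lt_iff _ (hpos j) (A.exclusionRadius_pos _ _ (hpos 0)), not_lt] at hj'
    have hD : D (N.link j ω) ≤ max (D .LOS) (D .NLOS) := by
      cases N.link j ω
      exacts [le_max_left _ _, le_max_right _ _]
    simpa using (hj'.trans hD).trans_lt hk
  obtain ⟨i, hi, hmax⟩ := ((hfin k).subset hsub).exists_maximalFor (fun j => N.siteLoss A j ω) _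
    ⟨0, le_refl (N.siteLoss A 0 ω)⟩
  refine ⟨i, fun j => ?_⟩
  rcases le_total (N.siteLoss A j ω) (N.siteLoss A i ω) with h | h
  · exact h
  · exact hmax (show N.siteLoss A 0 ω ≤ _ from le_trans hi h) h

variable [mΩ : MeasurableSpace Ω] {P : Measure Ω}

lemma HasLaw.ae_loc_ne_zero [IsProbabilityMeasure P] (hN : N.HasLaw A P) :
    ∀ᵐ ω ∂P, ∀ j, N.loc j ω ≠ 0 := by
  have hu : Measurable (Set.indicator ({0} : Set Plane) (1 : Plane → ℝ≥0∞)) :=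
    measurable_one.indicator (measurableSet_singleton _)
  have h := hN.loc_poisson.campbell hu
  rw [lintegral_indicator_one (measurableSet_singleton _), Measure.smul_apply, measure_singleton,
    smul_zero] at h
  replace h := (lintegral_eq_zero_iff (Measurable.tsum fun j =>
    hu.comp (hN.loc_poisson.measurable j))).1 h
  filter_upwards [h] with ω hω j hj
  have := ENNReal.tsum_eq_zero.1 hω j
  simp [hj] at this

lemma HasLaw.ae_finite_ball [IsProbabilityMeasure P] (hN : N.HasLaw A P) :
    ∀ᵐ ω ∂P, ∀ k : ℕ, {j | N.loc j ω ∈ Metric.ball 0 (k : ℝ)}.Finite := by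
  refine ae_all_iff.2 fun k => ?_
  filter_upwards [hN.loc_poisson.pointCount_ne_top (B := Metric.ball 0 (k : ℝ)) measurableSet_ball
    (by rw [Measure.smul_apply, smul_eq_mul]
        exact ENNReal.mul_ne_top ENNReal.ofReal_ne_top measure_ball_lt_top.ne)] with ω hω
  exact Set.encard_ne_top_iff.1 hω

/-- Almost surely, no two sites have the same path loss, whatever their link types. -/
lemma HasLaw.ae_siteLoss_ne [IsProbabilityMeasure P] (hN : N.HasLaw A P) :
    ∀ᵐ ω ∂P, ∀ i j, j ≠ i → N.siteLoss A j ω ≠ N.siteLoss A i ω := by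
  -- a tie between link types `s` and `p` means that one distance is a function of the other
  have h (s p : LinkType) : ∀ᵐ ω ∂P, ∀ i j, j ≠ i →
      ‖N.loc j ω‖ ≠ A.exclusionRadius s p ‖N.loc i ω‖ := by
    refine hN.loc_poisson.ae_ne (φ := fun z => A.exclusionRadius s p ‖z‖) (ψ := fun y => ‖y‖)
      ((A.measurable_exclusionRadius s p).comp measurable_norm) measurable_norm ?_ ?_
    · intro r
      have hsub : (fun y : Plane => ‖y‖) ⁻¹' Metric.closedBall r 1 ⊆
          Metric.closedBall 0 (r + 1) := by
        intro y hy
        have := (abs_le.1 (show |‖y‖ - r| ≤ 1 from hy)).2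
        simpa using (by linarith : ‖y‖ ≤ r + 1)
      refine ne_top_of_le_ne_top ?_ (measure_mono hsub)
      rw [Measure.smul_apply, smul_eq_mul]
      exact ENNReal.mul_ne_top ENNReal.ofReal_ne_top measure_closedBall_lt_top.ne
    · intro r
      have : (fun y : Plane => ‖y‖) ⁻¹' {r} = Metric.sphere 0 r := by ext; simp
      rw [this, Measure.smul_apply, Measure.addHaar_sphere, smul_zero]
  have h' : ∀ᵐ ω ∂P, ∀ s p i j, j ≠ i → ‖N.loc j ω‖ ≠ A.exclusionRadius s p ‖N.loc i ω‖ :=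
    ae_all_iff.2 fun s => ae_all_iff.2 (h s)
  filter_upwards [h', hN.ae_loc_ne_zero] with ω hω h0 i j hji heq
  have hi := norm_pos_iff.2 (h0 i)
  have hj := norm_pos_iff.2 (h0 j)
  unfold siteLoss at heq
  refine hω (N.link i ω) (N.link j ω) i j hji (le_antisymm ?_ ?_)
  · rw [← A.pathLoss_exclusionRadius _ (N.link j ω) hi] at heq
    by_contra hlt
    exact ((A.pathLoss_lt_iff _ hj (A.exclusionRadius_pos _ _ hi)).2 (not_le.1 hlt)).ne heq
  · exact (A.pathLoss_le_iff _ _ hi hj).1 heq.le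

theorem HasLaw.ae_existsUnique_isServing [IsProbabilityMeasure P] (hN : N.HasLaw A P)
    (n : Fin M) : ∀ᵐ ω ∂P, ∃! i, N.IsServing A n ω i := by
  filter_upwards [hN.ae_loc_ne_zero, hN.ae_finite_ball, hN.ae_siteLoss_ne] with ω h0 hfin hne
  obtain ⟨i, hi⟩ := exists_forall_siteLoss_le (A := A) h0 hfin
  have hs : N.IsServing A n ω i :=
    isServing_iff.2 fun j hj => lt_of_le_of_ne (hi j) (hne i j hj)
  exact ⟨i, hs, fun j hj => hj.unique hs⟩

lemma HasLaw.measurable_serving (hN : N.HasLaw A P) (n : Fin M) : Measurable (N.serving A n) := by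
  have hset (i : ℕ) : MeasurableSet {ω | N.IsServing A n ω i} := by
    have : {ω | N.IsServing A n ω i} =
        ⋂ j, ⋂ (_ : j ≠ i), {ω | N.siteLoss A j ω < N.siteLoss A i ω} := by
      ext ω; simp only [Set.mem_ofPred_eq, isServing_iff, Set.mem_iInter]
    rw [this]
    exact MeasurableSet.iInter fun j => MeasurableSet.iInter fun _ =>
      measurableSet_lt (hN.measurable_siteLoss j) (hN.measurable_siteLoss i)
  refine measurable_to_countable' fun i => ?_
  have : N.serving A n ⁻¹' {i} = {ω | N.IsServing A n ω i} ∪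
      ({ω | i = 0} ∩ (⋃ j, {ω | N.IsServing A n ω j})ᶜ) := by
    ext ω
    simp only [Set.mem_preimage, Set.mem_singleton_iff, Set.mem_union, Set.mem_inter_iff,
      Set.mem_ofPred_eq, Set.mem_compl_iff, Set.mem_iUnion]
    constructor
    · intro h
      by_cases hex : ∃ j, N.IsServing A n ω j
      · obtain ⟨j, hj⟩ := hex
        left
        rwa [← h, hj.serving_eq]
      · right
        refine ⟨?_, hex⟩
        have he : {i | N.IsServing A n ω i} = ∅ := by
          ext j; simpa using fun hj => hex ⟨j, hj⟩
        rw [← h, serving, he, Nat.sInf_empty]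
    · rintro (h | ⟨h, hex⟩)
      · exact h.serving_eq
      · have he : {i | N.IsServing A n ω i} = ∅ := by
          ext j; simpa using fun hj => hex ⟨j, hj⟩
        rw [serving, he, Nat.sInf_empty, h]
  rw [this]
  exact (hset i).union ((MeasurableSet.const _).inter (MeasurableSet.iUnion hset).compl)

lemma HasLaw.measurable_servingLink (hN : N.HasLaw A P) (n : Fin M) :
    Measurable (N.servingLink A n) := by
  have : Measurable fun q : ℕ × Ω => N.link q.1 q.2 :=
    measurable_from_prod_countable_right hN.measurable_link
  exact this.comp ((hN.measurable_serving n).prodMk measurable_id)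

lemma HasLaw.measurable_servingDist (hN : N.HasLaw A P) (n : Fin M) :
    Measurable (N.servingDist A n) := by
  have : Measurable fun q : ℕ × Ω => N.loc q.1 q.2 :=
    measurable_from_prod_countable_right hN.loc_poisson.measurable
  have h : Measurable fun ω => N.loc (N.serving A n ω) ω :=
    this.comp ((hN.measurable_serving n).prodMk measurable_id)
  exact measurable_norm.comp h

end Network

/-! ### The conditional Laplace transform of the interference -/

namespace Params

variable {M : ℕ} (A : Params M)

lemma mixtureProd_zero_left (Q : Finset (Fin M)) (l : ℝ) : A.mixtureProd Q 0 l = 1 := by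
  simp [mixtureProd, mixture_zero_left]

/-- The mean measure of the exponent splits into the void part, which does not depend on `t`, and
the interference part outside the exclusion radii. -/
lemma lintegral_one_sub_siteFactor (Q : Finset (Fin M)) {t : ℝ} (ht : 0 ≤ t) (s : LinkType) {x : ℝ}
    (hx : 0 < x) :
    ∫⁻ y, (1 - A.siteFactor Q t (A.pathLoss s x) y) ∂(ENNReal.ofReal A.density • volume) =
      ∫⁻ y, (1 - A.siteFactor Q 0 (A.pathLoss s x) y) ∂(ENNReal.ofReal A.density • volume) +
        ∑ p, ENNReal.ofReal (2 * Real.pi * A.density) *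
          ∫⁻ y in Set.Ioi (A.exclusionRadius s p x), ENNReal.ofReal
            (A.linkProb p y * (1 - ∏ m ∈ Q, A.mixture t (A.pathLoss p y) m) * y) := by
  set r := A.pathLoss s x
  set h : LinkType → ℝ → ℝ≥0∞ := fun p y => ENNReal.ofReal (A.linkProb p y) *
    if A.pathLoss p y ≤ r then 1 - A.mixtureProd Q t (A.pathLoss p y) else 0 with hh
  have hhm (p : LinkType) : Measurable (h p) := by
    refine (A.measurable_linkProb p).ennreal_ofReal.mul (Measurable.ite
      (measurableSet_le (A.measurable_pathLoss p) measurable_const) ?_ measurable_const)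
    exact measurable_const.sub ((A.measurable_mixtureProd Q t).comp (A.measurable_pathLoss p))
  have hsplit (y : Plane) : 1 - A.siteFactor Q t r y =
      (1 - A.siteFactor Q 0 r y) + ∑ p, h p ‖y‖ := by
    have h1 : A.siteFactor Q 0 r y = ∑ p, h p ‖y‖ + A.siteFactor Q t r y := by
      simp only [siteFactor, ← Finset.sum_add_distrib, hh, ← mul_add]
      refine Finset.sum_congr rfl fun p _ => ?_
      congr 1
      split_ifs
      · rw [mixtureProd_zero_left, tsub_add_cancel_of_le
          (A.mixtureProd_le_one Q ht (A.pathLoss_nonneg p (norm_nonneg y)))]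
      · simp
    refine ENNReal.sub_eq_of_eq_add
      (ne_top_of_le_ne_top ENNReal.one_ne_top (A.siteFactor_le_one Q ht r y)) ?_
    rw [add_assoc, ← h1, tsub_add_cancel_of_le (A.siteFactor_le_one Q le_rfl r y)]
  have h0m : Measurable fun y : Plane => 1 - A.siteFactor Q 0 r y :=
    measurable_const.sub (A.measurable_siteFactor_comp Q 0 measurable_const measurable_id)
  simp_rw [hsplit]
  rw [lintegral_add_left h0m, lintegral_finsetSum (f := fun p (y : Plane) => h p ‖y‖) _
    fun p _ => (hhm p).comp measurable_norm]
  congr 1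
  refine Finset.sum_congr rfl fun p _ => ?_
  set D := A.exclusionRadius s p x
  have hD0 : 0 < D := A.exclusionRadius_pos s p hx
  -- the boundary point `y = D` is a null set
  have hdom : ∫⁻ y in Set.Ioi (0 : ℝ), ENNReal.ofReal y * h p y =
      ∫⁻ y in Set.Ioi D, ENNReal.ofReal
        (A.linkProb p y * (1 - ∏ m ∈ Q, A.mixture t (A.pathLoss p y) m) * y) := by
    rw [← lintegral_indicator measurableSet_Ioi, setLIntegral_congr Ioi_ae_eq_Ici,
      ← lintegral_indicator measurableSet_Ici]
    refine lintegral_congr fun y => ?_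
    by_cases hy : 0 < y
    · rw [Set.indicator_of_mem (Set.mem_Ioi.2 hy)]
      have hiff : A.pathLoss p y ≤ r ↔ D ≤ y := A.pathLoss_le_iff s p hx hy
      by_cases hyD : D ≤ y
      · rw [Set.indicator_of_mem (Set.mem_Ici.2 hyD)]
        have hpl := A.pathLoss_nonneg p hy.le
        have hmix : 0 ≤ ∏ m ∈ Q, A.mixture t (A.pathLoss p y) m :=
          Finset.prod_nonneg fun m _ => A.mixture_nonneg ht hpl m
        have hlp := A.linkProb_nonneg p hy.le
        simp only [hh, if_pos (hiff.2 hyD), mixtureProd]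
        rw [← ENNReal.ofReal_prod_of_nonneg fun m _ => A.mixture_nonneg ht hpl m,
          ← ENNReal.ofReal_one, ← ENNReal.ofReal_sub _ hmix, ← ENNReal.ofReal_mul hlp,
          ← ENNReal.ofReal_mul hy.le]
        congr 1; ring
      · rw [Set.indicator_of_notMem (fun h => hyD (Set.mem_Ici.1 h))]
        simp only [hh, if_neg (fun h => hyD (hiff.1 h)), mul_zero]
    · rw [Set.indicator_of_notMem (fun h => hy (Set.mem_Ioi.1 h)),
        Set.indicator_of_notMem fun h => hy (hD0.trans_le (Set.mem_Ici.1 h))]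
  rw [lintegral_smul_measure, lintegral_comp_norm_plane (hhm p), hdom, smul_eq_mul, ← mul_assoc,
    ← ENNReal.ofReal_mul A.density_pos.le, mul_comm A.density]

/-- The conditional Laplace transform of the interference given a serving link of type `s` and
length `x`. -/
noncomputable def condLaplace (Q : Finset (Fin M)) (n : Fin M) (t : ℝ) (s : LinkType) (x : ℝ) :
    ℝ≥0∞ :=
  A.mixtureProd (Q.erase n) t (A.pathLoss s x) *
    ∏ p, eExp (ENNReal.ofReal (2 * Real.pi * A.density) *
      ∫⁻ y in Set.Ioi (A.exclusionRadius s p x), ENNReal.ofReal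
        (A.linkProb p y * (1 - ∏ m ∈ Q, A.mixture t (A.pathLoss p y) m) * y))

lemma condLaplace_le_one (Q : Finset (Fin M)) (n : Fin M) {t : ℝ} (ht : 0 ≤ t) (s : LinkType)
    {x : ℝ} (hx : 0 ≤ x) : A.condLaplace Q n t s x ≤ 1 :=
  mul_le_one' (A.mixtureProd_le_one _ ht (A.pathLoss_nonneg s hx))
    (Finset.prod_le_one' fun _ _ => eExp_le_one _)

lemma measurable_condLaplace (Q : Finset (Fin M)) (n : Fin M) (t : ℝ) (s : LinkType) :
    Measurable (A.condLaplace Q n t s) := by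
  refine ((A.measurable_mixtureProd _ t).comp (A.measurable_pathLoss s)).mul
    (Finset.measurable_fun_prod _ fun p _ => measurable_eExp.comp (Measurable.const_mul ?_ _))
  have hF : Measurable fun y : ℝ => ENNReal.ofReal
      (A.linkProb p y * (1 - ∏ m ∈ Q, A.mixture t (A.pathLoss p y) m) * y) :=
    (((A.measurable_linkProb p).mul (measurable_const.sub (Finset.measurable_fun_prod _ fun m _ =>
      (A.measurable_mixture t m).comp (A.measurable_pathLoss p)))).mul measurable_id).ennreal_ofReal
  have hS : MeasurableSet {q : ℝ × ℝ | A.exclusionRadius s p q.1 < q.2} :=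
    measurableSet_lt ((A.measurable_exclusionRadius s p).comp measurable_fst) measurable_snd
  have := ((hF.comp measurable_snd).indicator hS).lintegral_prod_right' (ν := volume)
  convert this using 2 with x
  rw [← lintegral_indicator measurableSet_Ioi]
  rfl

lemma toReal_condLaplace (Q : Finset (Fin M)) (n : Fin M) {t : ℝ} (ht : 0 ≤ t) (s : LinkType)
    {x : ℝ} (hx : 0 ≤ x) : (A.condLaplace Q n t s x).toReal =
      (∏ m ∈ Q.erase n, A.mixture t (A.pathLoss s x) m) *
        ∏ p : LinkType, expNeg (ENNReal.ofReal (2 * Real.pi * A.density) *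
          ∫⁻ y in Set.Ioi (A.exclusionRadius s p x), ENNReal.ofReal
            (A.linkProb p y * (1 - ∏ m ∈ Q, A.mixture t (A.pathLoss p y) m) * y)) := by
  rw [condLaplace, ENNReal.toReal_mul, mixtureProd, ENNReal.toReal_prod, ENNReal.toReal_prod]
  simp_rw [toReal_eExp]
  congr 1
  exact Finset.prod_congr rfl fun m _ =>
    ENNReal.toReal_ofReal (A.mixture_nonneg ht (A.pathLoss_nonneg s hx) m)

end Params

namespace Network

variable {Ω : Type*} {M : ℕ} {N : Network Ω M} {A : Params M}

/-- Only the serving site contributes to the sum over all candidates for the strongest site. -/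
lemma tsum_strongest_eq {n : Fin M} {ω : Ω} (hs : ∃ i, N.IsServing A n ω i)
    (he : ∀ m j, 0 ≤ N.emitted A m j ω) (Q : Finset (Fin M)) {t : ℝ} (ht : 0 ≤ t)
    (U : LinkType → ℝ → ℝ≥0∞) :
    ∑' i, U (N.link i ω) ‖N.loc i ω‖ *
        eExp (∑ m ∈ Q.erase n, ENNReal.ofReal (t * (N.siteLoss A i ω * N.emitted A m i ω))) *
        eExp (∑' j, if j = i then 0 else N.exponent A Q t i j ω) =
      U (N.servingLink A n ω) (N.servingDist A n ω) *
        eExp (ENNReal.ofReal t * N.interference A Q n ω) := by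
  classical
  obtain ⟨i, hi⟩ := hs
  have hlt := isServing_iff.1 hi
  have hterm (Q' : Finset (Fin M)) (j : ℕ) :
      ∑ m ∈ Q', ENNReal.ofReal (t * (N.siteLoss A j ω * N.emitted A m j ω)) =
        ENNReal.ofReal t * ENNReal.ofReal (N.siteLoss A j ω * ∑ m ∈ Q', N.emitted A m j ω) := by
    rw [← ENNReal.ofReal_sum_of_nonneg fun m _ =>
      mul_nonneg ht (mul_nonneg (siteLoss_nonneg A j ω) (he m j)), ← ENNReal.ofReal_mul ht,
      Finset.mul_sum, Finset.mul_sum]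
  have hI : N.interference A Q n ω =
      ENNReal.ofReal (N.siteLoss A i ω * ∑ m ∈ Q.erase n, N.emitted A m i ω) +
        ∑' j, if j = i then 0
          else ENNReal.ofReal (N.siteLoss A j ω * ∑ m ∈ Q, N.emitted A m j ω) := by
    unfold interference servingLink servingDist
    rw [hi.serving_eq]
    congr 1
    have (p : LinkType) : ∑' j : {j : ℕ // N.link j ω = p ∧ j ≠ i},
        ENNReal.ofReal (A.pathLoss p ‖N.loc j ω‖ * ∑ m ∈ Q, N.emitted A m j ω) =
        ∑' j, Set.indicator {j | N.link j ω = p ∧ j ≠ i}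
          (fun j => ENNReal.ofReal (A.pathLoss p ‖N.loc j ω‖ * ∑ m ∈ Q, N.emitted A m j ω)) j :=
      tsum_subtype {j | N.link j ω = p ∧ j ≠ i}
        fun j => ENNReal.ofReal (A.pathLoss p ‖N.loc j ω‖ * ∑ m ∈ Q, N.emitted A m j ω)
    simp_rw [this]
    rw [← Summable.tsum_finsetSum fun _ _ => ENNReal.summable]
    refine tsum_congr fun j => ?_
    by_cases hj : j = i
    · simp [hj]
    · rw [if_neg hj, Finset.sum_eq_single (N.link j ω)]
      · rw [Set.indicator_of_mem (show j ∈ {j' | N.link j' ω = N.link j ω ∧ j' ≠ i} from ⟨rfl, hj⟩)]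
        rfl
      · intro p _ hp
        exact Set.indicator_of_notMem (fun h => hp h.1.symm) _
      · simp
  rw [tsum_eq_single i]
  · have hexp : (∑' j, if j = i then 0 else N.exponent A Q t i j ω) = ENNReal.ofReal t *
        ∑' j, if j = i then 0
          else ENNReal.ofReal (N.siteLoss A j ω * ∑ m ∈ Q, N.emitted A m j ω) := by
      rw [← ENNReal.tsum_mul_left]
      refine tsum_congr fun j => ?_
      split_ifs with hj
      · simp
      · rw [exponent, if_pos (hlt j hj).le, hterm]
    rw [hI, mul_add, eExp_add, hexp, hterm, mul_assoc]
    unfold servingLink servingDist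
    rw [hi.serving_eq]
  · intro j hj
    -- the serving site is stronger than site `j`, which makes the exponent infinite
    have : (∑' j', if j' = j then 0 else N.exponent A Q t j j' ω) = ∞ :=
      ENNReal.tsum_eq_top_of_eq_top ⟨i, by
        rw [if_neg hj.symm, exponent, if_neg (not_le.2 (hlt j hj))]⟩
    rw [this, eExp_top, mul_zero]

variable [mΩ : MeasurableSpace Ω] {P : Measure Ω}

lemma HasLaw.ae_emitted_nonneg (hN : N.HasLaw A P) :
    ∀ᵐ ω ∂P, ∀ m j, 0 ≤ N.emitted A m j ω := by
  have hexp : expMeasure 1 (Set.Iio 0) = 0 := by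
    have h1 : expMeasure 1 = volume.withDensity (exponentialPDF 1) := rfl
    rw [h1, withDensity_apply _ measurableSet_Iio]
    exact lintegral_exponentialPDF_of_nonpos le_rfl
  have h (m : Fin M) (j : ℕ) : ∀ᵐ ω ∂P, 0 ≤ N.fading m j ω := by
    rw [← hN.fading_law m j, Measure.map_apply (hN.measurable_fading m j) measurableSet_Iio] at hexp
    rw [ae_iff]
    simp only [not_le]
    exact hexp
  filter_upwards [ae_all_iff.2 fun m => ae_all_iff.2 (h m)] with ω hω m j
  refine mul_nonneg (mul_nonneg (mul_nonneg (A.power_pos m).le (hω m j)) (A.antenna_nonneg _)) ?_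
  split_ifs <;> norm_num

lemma HasLaw.measurable_strongest_term (hN : N.HasLaw A P) (Q : Finset (Fin M)) (n : Fin M) (t : ℝ)
    {U : LinkType → ℝ → ℝ≥0∞} (hU : ∀ p, Measurable (U p)) (i : ℕ) :
    Measurable fun ω => U (N.link i ω) ‖N.loc i ω‖ *
      eExp (∑ m ∈ Q.erase n, ENNReal.ofReal (t * (N.siteLoss A i ω * N.emitted A m i ω))) *
      eExp (∑' j, if j = i then 0 else N.exponent A Q t i j ω) := by
  refine (Measurable.mul ?_ (measurable_eExp.comp ?_)).mul (measurable_eExp.comp ?_)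
  · exact (measurable_comp_siteAlg (g := fun p y => U p ‖y‖)
      (fun p => (hU p).comp measurable_norm) i).mono hN.siteAlg_le le_rfl
  · exact Finset.measurable_fun_sum _ fun m _ => (((hN.measurable_siteLoss i).mul
      (hN.measurable_emitted m i)).const_mul t).ennreal_ofReal
  · refine Measurable.tsum fun j => ?_
    split_ifs
    · exact measurable_const
    · exact hN.measurable_exponent Q t i j

lemma HasLaw.aemeasurable_eExp_interference [IsProbabilityMeasure P] (hN : N.HasLaw A P)
    (Q : Finset (Fin M)) (n : Fin M) {t : ℝ} (ht : 0 ≤ t) :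
    AEMeasurable (fun ω => eExp (ENNReal.ofReal t * N.interference A Q n ω)) P := by
  have hm : Measurable fun ω => ∑' i, 1 *
      eExp (∑ m ∈ Q.erase n, ENNReal.ofReal (t * (N.siteLoss A i ω * N.emitted A m i ω))) *
      eExp (∑' j, if j = i then 0 else N.exponent A Q t i j ω) := Measurable.tsum fun i =>
    hN.measurable_strongest_term Q n t (U := fun _ _ => 1) (fun _ => measurable_const) i
  refine ⟨_, hm, ?_⟩
  filter_upwards [hN.ae_existsUnique_isServing n, hN.ae_emitted_nonneg] with ω hs he
  rw [tsum_strongest_eq hs.exists he Q ht (fun _ _ => 1), one_mul]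

/-- The joint law of type and length of the serving link, weighted with the Laplace transform of
the interference. -/
lemma HasLaw.lintegral_mul_eExp_interference [IsProbabilityMeasure P] (hN : N.HasLaw A P)
    (Q : Finset (Fin M)) (n : Fin M) {t : ℝ} (ht : 0 ≤ t) {U : LinkType → ℝ → ℝ≥0∞}
    (hU : ∀ p, Measurable (U p)) (hU1 : ∀ p x, 0 ≤ x → U p x ≤ 1) :
    ∫⁻ ω, U (N.servingLink A n ω) (N.servingDist A n ω) *
        eExp (ENNReal.ofReal t * N.interference A Q n ω) ∂P =
      ∑ s, ∫⁻ z : Plane, ENNReal.ofReal (A.linkProb s ‖z‖) * (U s ‖z‖ *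
        A.mixtureProd (Q.erase n) t (A.pathLoss s ‖z‖)) *
        eExp (∫⁻ y, (1 - A.siteFactor Q t (A.pathLoss s ‖z‖) y)
          ∂(ENNReal.ofReal A.density • volume)) ∂(ENNReal.ofReal A.density • volume) := by
  rw [← hN.lintegral_tsum_strongest Q n ht (u := fun p y => U p ‖y‖)
    (fun p => (hU p).comp measurable_norm) (fun p y => hU1 p _ (norm_nonneg y)),
    ← lintegral_tsum fun i => (hN.measurable_strongest_term Q n t hU i).aemeasurable]
  refine lintegral_congr_ae ?_
  filter_upwards [hN.ae_existsUnique_isServing n, hN.ae_emitted_nonneg] with ω hs he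
  exact (tsum_strongest_eq hs.exists he Q ht U).symm

/-- `condLaplace` is the Radon-Nikodym density, with respect to the law of type and length of the
serving link, of that law weighted with the Laplace transform of the interference. -/
lemma HasLaw.lintegral_mul_condLaplace [IsProbabilityMeasure P] (hN : N.HasLaw A P)
    (Q : Finset (Fin M)) (n : Fin M) {t : ℝ} (ht : 0 ≤ t) {U : LinkType → ℝ → ℝ≥0∞}
    (hU : ∀ p, Measurable (U p)) (hU1 : ∀ p x, 0 ≤ x → U p x ≤ 1) :
    ∫⁻ ω, U (N.servingLink A n ω) (N.servingDist A n ω) *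
        A.condLaplace Q n t (N.servingLink A n ω) (N.servingDist A n ω) ∂P =
      ∫⁻ ω, U (N.servingLink A n ω) (N.servingDist A n ω) *
        eExp (ENNReal.ofReal t * N.interference A Q n ω) ∂P := by
  -- at `t = 0` the formula gives the unweighted law of type and length of the serving link
  have h0 := hN.lintegral_mul_eExp_interference Q n le_rfl
    (U := fun p x => U p x * A.condLaplace Q n t p x)
    (fun p => (hU p).mul (A.measurable_condLaplace Q n t p))
    (fun p x hx => mul_le_one' (hU1 p x hx) (A.condLaplace_le_one Q n ht p hx))
  simp only [ENNReal.ofReal_zero, zero_mul, eExp_zero, mul_one, Params.mixtureProd_zero_left] at h0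
  rw [h0, hN.lintegral_mul_eExp_interference Q n ht hU hU1]
  refine Finset.sum_congr rfl fun s _ => lintegral_congr_ae ?_
  have hz : ∀ᵐ z ∂(ENNReal.ofReal A.density • (volume : Measure Plane)), z ≠ 0 := by
    rw [ae_iff]
    simp
  filter_upwards [hz] with z hz
  rw [A.lintegral_one_sub_siteFactor Q ht s (norm_pos_iff.2 hz), eExp_add, eExp_sum,
    Params.condLaplace]
  ring

end Network

end MmWave

theorem mainTheorem6 {Ω : Type*} [MeasurableSpace Ω] (P : Measure Ω) [IsProbabilityMeasure P]
    {M : ℕ} (A : MmWave.Params M) (N : MmWave.Network Ω M) (hN : N.HasLaw A P)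
    (Q : Finset (Fin M)) (n : Fin M) (hn : n ∈ Q) (t : ℝ) (ht : 0 ≤ t) :
    (∀ᵐ ω ∂P, ∃! i, N.IsServing A n ω i) ∧
    P[fun ω => MmWave.expNeg (ENNReal.ofReal t * N.interference A Q n ω) |
        MeasurableSpace.comap (fun ω => (N.servingLink A n ω, N.servingDist A n ω))
          inferInstance]
      =ᵐ[P] fun ω =>
        let s := N.servingLink A n ω
        let x := N.servingDist A n ω
        (∏ m ∈ Q.erase n, A.mixture t (A.pathLoss s x) m) *
          ∏ p : MmWave.LinkType, MmWave.expNeg (ENNReal.ofReal (2 * Real.pi * A.density) *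
            ∫⁻ y in Set.Ioi (A.exclusionRadius s p x), ENNReal.ofReal
              (A.linkProb p y * (1 - ∏ m ∈ Q, A.mixture t (A.pathLoss p y) m) * y)) := by
  refine ⟨hN.ae_existsUnique_isServing n, ?_⟩
  have hpair : Measurable fun ω => (N.servingLink A n ω, N.servingDist A n ω) :=
    (hN.measurable_servingLink n).prodMk (hN.measurable_servingDist n)
  have hx0 (ω : Ω) : 0 ≤ N.servingDist A n ω := norm_nonneg _
  have hΓ : Measurable fun q : MmWave.LinkType × ℝ => A.condLaplace Q n t q.1 q.2 :=
    measurable_from_prod_countable_right fun s => A.measurable_condLaplace Q n t s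
  have hΓ1 (ω : Ω) : A.condLaplace Q n t (N.servingLink A n ω) (N.servingDist A n ω) ≤ 1 :=
    A.condLaplace_le_one Q n ht _ (hx0 ω)
  have haem := hN.aemeasurable_eExp_interference Q n ht
  have hR : (fun ω => (A.condLaplace Q n t (N.servingLink A n ω) (N.servingDist A n ω)).toReal) =
      fun ω =>
        let s := N.servingLink A n ω
        let x := N.servingDist A n ω
        (∏ m ∈ Q.erase n, A.mixture t (A.pathLoss s x) m) *
          ∏ p : MmWave.LinkType, MmWave.expNeg (ENNReal.ofReal (2 * Real.pi * A.density) *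
            ∫⁻ y in Set.Ioi (A.exclusionRadius s p x), ENNReal.ofReal
              (A.linkProb p y * (1 - ∏ m ∈ Q, A.mixture t (A.pathLoss p y) m) * y)) :=
    funext fun ω => A.toReal_condLaplace Q n ht _ (hx0 ω)
  rw [← hR]
  simp_rw [← MmWave.toReal_eExp]
  have hbound (f : Ω → ℝ≥0∞) (hf : ∀ ω, f ω ≤ 1) (hfm : AEMeasurable f P) :
      Integrable (fun ω => (f ω).toReal) P := by
    refine integrable_toReal_of_lintegral_ne_top hfm (ne_top_of_le_ne_top ENNReal.one_ne_top ?_)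
    calc ∫⁻ ω, f ω ∂P ≤ ∫⁻ _, 1 ∂P := lintegral_mono hf
      _ = 1 := by simp
  refine (ae_eq_condExp_of_forall_setIntegral_eq hpair.comap_le
    (hbound _ (fun ω => MmWave.eExp_le_one _) haem)
    (fun S _ _ => (hbound _ hΓ1 (hΓ.comp hpair).aemeasurable).integrableOn) ?_ ?_).symm
  · rintro S ⟨B, hB, rfl⟩ -
    set S := (fun ω => (N.servingLink A n ω, N.servingDist A n ω)) ⁻¹' B
    have hS : MeasurableSet S := hpair hB
    have h := hN.lintegral_mul_condLaplace Q n ht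
      (U := fun p x => B.indicator (fun _ => 1) (p, x))
      (fun p => (measurable_const.indicator hB).comp measurable_prodMk_left)
      (fun p x _ => Set.indicator_le_self B (fun _ => (1 : ℝ≥0∞)) (p, x))
    have hind (f : Ω → ℝ≥0∞) : ∫⁻ ω, B.indicator (fun _ => (1 : ℝ≥0∞))
        (N.servingLink A n ω, N.servingDist A n ω) * f ω ∂P = ∫⁻ ω in S, f ω ∂P := by
      rw [← lintegral_indicator hS]
      refine lintegral_congr fun ω => ?_
      by_cases hω : (N.servingLink A n ω, N.servingDist A n ω) ∈ B
      · rw [Set.indicator_of_mem hω, one_mul, Set.indicator_of_mem (show ω ∈ S from hω)]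
      · rw [Set.indicator_of_notMem hω, zero_mul, Set.indicator_of_notMem (show ω ∉ S from hω)]
    rw [hind, hind] at h
    have hint (f : Ω → ℝ≥0∞) (hf : ∀ ω, f ω ≤ 1) (hfm : AEMeasurable f P) :
        ∫ ω in S, (f ω).toReal ∂P = (∫⁻ ω in S, f ω ∂P).toReal :=
      integral_toReal hfm.restrict
        (Filter.Eventually.of_forall fun ω => (hf ω).trans_lt ENNReal.one_lt_top)
    exact (hint _ hΓ1 (hΓ.comp hpair).aemeasurable).trans <| (congrArg ENNReal.toReal h).trans
      (hint _ (fun ω => MmWave.eExp_le_one _) haem).symm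
  · exact (hΓ.ennreal_toReal.comp
      (comap_measurable fun ω => (N.servingLink A n ω, N.servingDist A n ω))).stronglyMeasurable
      |>.aestronglyMeasurable
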